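/- Let $k$ be a field of characteristic zero and $G$ a finite group. **The algebra $E_G$.** For a finite group $A$, let $\Xi(A)$ be the quotient of the free abelian group on the isomorphism classes $[f\colon X\to Y]$ of morphisms of finite $A$-sets by the relations $[X_1\sqcup X_2\xrightarrow{f} Y]=[X_1\to f(X_1)]+[X_2\to f(X_2)]$, and let $\Gamma(A)\subseteq\Xi(A)$ be the section Burnside ring: the subgroup generated by the classes of Galois morphisms, i.e. of those $f\colon X\to Y$ such that $f(x)=f(x')$ implies $x'=\varphi(x)$ and $f\circ\varphi=f$ for some automorphism $\varphi$ of the $A$-set $X$. The algebra $E_G=k\otimes_{\mathbb Z}\Gamma(G\times G)$ has the multiplication induced by the composition $(f,f')\mapsto f\times_G f'$ of morphisms of $(G,G)$-bisets, where $f\times_G f'\colon X\times_G X'\to Y\times_G Y'$. A section $(T,S)$ of $G\times G$ is a pair of subgroups $S\trianglelefteq T\le G\times G$; it has a class $\left[\frac{G\times G}{S\trianglelefteq T}\right]\in E_G$, that of the projection $(G\times G)/S\to(G\times G)/T$. For a subgroup $U\le G\times G$ let $p_1(U),p_2(U)$ be its projections and $k_1(U)=\{g:(g,1)\in U\}$,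 $k_2(U)=\{g:(1,g)\in U\}$; put $l(T,S)=(p_1(T),k_1(T),p_1(S),k_1(S))$ and $r(T,S)=(p_2(T),k_2(T),p_2(S),k_2(S))$. The section $(T,S)$ is covering if $p_1(T)=p_2(T)=G$ and $k_1(S)=k_2(S)=1$. The covering algebra $E_G^c\subseteq E_G$ is the subalgebra spanned over $k$ by the classes of all covering sections of $G\times G$. **Pairs, linkage, idempotents.** Let $\mathcal G_G$ be the set of pairs $(K,P)$ of normal subgroups of $G$ with $[K,P]=1$, partially ordered by $(K,P)\preceq(L,Q)$ iff $K\le L$ and $Q\le P$. Pairs $(K,P),(L,Q)\in\mathcal G_G$ are $G$-linked, written $(K,P)\sim_G(L,Q)$, if there is a section $(T,S)$ of $G\times G$ with $l(T,S)=(G,K,P,1)$ and $r(T,S)=(G,L,Q,1)$; this is an equivalence relation, and $\{K,P\}_G$ denotes the class of $(K,P)$. Let $\Delta_K(G)=\{(g,h)\in G\times G: h^{-1}g\in K\}$ and $\Delta(P)=\{(p,p):p\in P\}$, and put $$e_{(K,P)}=\frac1{|G:P|}\left[\frac{G\times G}{\Delta(P)\trianglelefteq\Delta_K(G)}\right],\qquad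 f_{(K,P)}=\sum_{(K,P)\preceq(L,Q)}\mu\big((K,P),(L,Q)\big)\,e_{(L,Q)},$$ where $\mu$ is the Möbius function of $\mathcal G_G$. The set $$\Gamma_{(G,K,P)}=\left\{\frac1{|G:P|}\left[\frac{G\times G}{S\trianglelefteq T}\right]:\ l(T,S)=(G,K,P,1)=r(T,S)\right\}$$ is a finite group under the multiplication of $E_G$, with identity $e_{(K,P)}$; let $k\Gamma_{(G,K,P)}$ be its group algebra. **Theorem.** Choose a representative $(K,P)$ of each $G$-linkage class, and an enumeration $\{K,P\}_G=\{(K_1,P_1),\dots,(K_n,P_n)\}$ of each class, where $n=|\{K,P\}_G|$. Then there is an isomorphism of $k$-algebras $$E_G^c\ \xrightarrow{\ \sim\ }\ \bigoplus_{\{K,P\}_G\in\mathcal G_G/\sim_G}\mathrm{Mat}_{|\{K,P\}_G|}\big(k\Gamma_{(G,K,P)}\big)$$ such that, for every linkage class $\{K,P\}_G$ and every $i=1,\dots,n$, the element $f_{(K_i,P_i)}$ lies in $E_G^c$ and is mapped to the element whose $\{K,P\}_G$-component is the $i$-th diagonal matrix idempotent $\mathrm{diag}(0,\dots,0,1,0,\dots,0)$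 and whose other components are $0$. -/

import Mathlib

open scoped TensorProduct

universe u v

noncomputable section

namespace SectionBurnside

/-! ### Morphisms of finite `A`-sets and the slice Burnside group -/

/-- A morphism `X → Y` of finite `A`-sets. -/
structure GSetHom (A : Type u) [Group A] where
  X : Type u
  Y : Type u
  [actX : MulAction A X]
  [actY : MulAction A Y]
  [finX : Finite X]
  [finY : Finite Y]
  toHom : X →[A] Y

attribute [instance] GSetHom.actX GSetHom.actY GSetHom.finX GSetHom.finY

section Slice

variable {A : Type u} [Group A]

/-- Two morphisms of `A`-sets are isomorphic if they are joined by a commutative square whose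
other two sides are isomorphisms (that is, bijective morphisms) of `A`-sets. -/
def GSetHom.Iso (M N : GSetHom A) : Prop :=
  ∃ (α : M.X →[A] N.X) (β : M.Y →[A] N.Y), Function.Bijective α ∧ Function.Bijective β ∧
    ∀ x, β (M.toHom x) = N.toHom (α x)

/-- `f : X → Y` is a Galois morphism if any two points of `X` with the same image are exchanged
by an automorphism `φ` of the `A`-set `X` with `f ∘ φ = f`. -/
def GSetHom.IsGalois (M : GSetHom A) : Prop :=
  ∀ x x' : M.X, M.toHom x = M.toHom x' →
    ∃ φ : M.X →[A] M.X, Function.Bijective φ ∧ (∀ z, M.toHom (φ z) = M.toHom z) ∧ φ x = x'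

/-- The image `f(U)` of a sub-`A`-set `U` of `X`. -/
def GSetHom.imageOf (M : GSetHom A) (U : SubMulAction A M.X) : SubMulAction A M.Y where
  carrier := M.toHom '' (U : Set M.X)
  smul_mem' := by
    rintro a _ ⟨x, hx, rfl⟩
    exact ⟨a • x, U.smul_mem a hx, map_smul M.toHom a x⟩

/-- The restriction `U → f(U)` of `f : X → Y` to a sub-`A`-set `U` of `X`. -/
def GSetHom.restrict (M : GSetHom A) (U : SubMulAction A M.X) : GSetHom A where
  X := U
  Y := M.imageOf U
  toHom :=
    { toFun := fun x => ⟨M.toHom x.1, x.1, x.2, rfl⟩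
      map_smul' := fun a x => Subtype.ext (map_smul M.toHom a x.1) }

theorem inverse_exists {X Y : Type u} [MulAction A X] [MulAction A Y] (α : X →[A] Y)
    (hα : Function.Bijective α) :
    ∃ β : Y →[A] X, (∀ x, β (α x) = x) ∧ (∀ y, α (β y) = y) ∧ Function.Bijective β := by
  let e := Equiv.ofBijective α hα
  refine ⟨⟨e.symm, fun a y => ?_⟩, fun x => e.symm_apply_apply x,
    fun y => e.apply_symm_apply y, e.symm.bijective⟩
  apply hα.1
  have h1 : α (e.symm (a • y)) = a • y := e.apply_symm_apply _
  have h2 : α (e.symm y) = y := e.apply_symm_apply _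
  simp only [id_eq, map_smul, h1, h2]

variable (A) in
/-- Isomorphism of morphisms of finite `A`-sets, as an equivalence relation. -/
def isoSetoid : Setoid (GSetHom A) where
  r := GSetHom.Iso
  iseqv :=
    { refl := fun M => ⟨MulActionHom.id A, MulActionHom.id A, Function.bijective_id,
        Function.bijective_id, fun _ => rfl⟩
      symm := by
        rintro M N ⟨α, β, hα, hβ, h⟩
        obtain ⟨α', h1, h2, h3⟩ := inverse_exists α hα
        obtain ⟨β', h4, h5, h6⟩ := inverse_exists β hβ
        refine ⟨α', β', h3, h6, fun x => hβ.1 ?_⟩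
        rw [h5, h, h2]
      trans := by
        rintro M N L ⟨α, β, hα, hβ, h⟩ ⟨α', β', hα', hβ', h'⟩
        refine ⟨α'.comp α, β'.comp β, hα'.comp hα, hβ'.comp hβ, fun x => ?_⟩
        simp [h, h'] }

variable (A) in
/-- The free abelian group on the isomorphism classes of morphisms of finite `A`-sets. -/
abbrev FreeMor : Type (u + 1) := FreeAbelianGroup (Quotient (isoSetoid A))

/-- The isomorphism class of a morphism, as an element of the free abelian group. -/
def freeMk (M : GSetHom A) : FreeMor A := FreeAbelianGroup.of (Quotient.mk (isoSetoid A) M)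

variable (A) in
/-- The relations `[X₁ ⊔ X₂ → Y] - [X₁ → f(X₁)] - [X₂ → f(X₂)]`. -/
def sliceRelations : AddSubgroup (FreeMor A) :=
  AddSubgroup.closure { r | ∃ (M : GSetHom A) (U V : SubMulAction A M.X),
    IsCompl (U : Set M.X) (V : Set M.X) ∧
      r = freeMk M - freeMk (M.restrict U) - freeMk (M.restrict V) }

variable (A) in
/-- The slice Burnside group `Ξ(A)`. -/
def SliceBurnside : Type (u + 1) := FreeMor A ⧸ sliceRelations A

instance : AddCommGroup (SliceBurnside A) :=
  inferInstanceAs (AddCommGroup (FreeMor A ⧸ sliceRelations A))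

/-- The class of a morphism of finite `A`-sets in `Ξ(A)`. -/
def mk (M : GSetHom A) : SliceBurnside A := QuotientAddGroup.mk' (sliceRelations A) (freeMk M)

theorem mk_eq_of_iso {M N : GSetHom A} (h : M.Iso N) : mk M = mk N := by
  have : Quotient.mk (isoSetoid A) M = Quotient.mk (isoSetoid A) N := Quotient.sound h
  unfold mk freeMk
  rw [this]

theorem mk_eq_restrict_add (M : GSetHom A) (U V : SubMulAction A M.X)
    (h : IsCompl (U : Set M.X) (V : Set M.X)) :
    mk M = mk (M.restrict U) + mk (M.restrict V) := by
  have h1 : freeMk M - freeMk (M.restrict U) - freeMk (M.restrict V) ∈ sliceRelations A :=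
    AddSubgroup.subset_closure ⟨M, U, V, h, rfl⟩
  have h2 := (QuotientAddGroup.eq_zero_iff _).2 h1
  have h3 : mk M - mk (M.restrict U) - mk (M.restrict V) = 0 := h2
  rw [sub_sub, sub_eq_zero] at h3
  exact h3

/-- Additive maps out of `Ξ(A)`. -/
def lift {B : Type*} [AddCommGroup B] (F : GSetHom A → B)
    (hiso : ∀ M N : GSetHom A, M.Iso N → F M = F N)
    (hadd : ∀ (M : GSetHom A) (U V : SubMulAction A M.X),
      IsCompl (U : Set M.X) (V : Set M.X) → F M = F (M.restrict U) + F (M.restrict V)) :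
    SliceBurnside A →+ B :=
  QuotientAddGroup.lift (sliceRelations A)
    (FreeAbelianGroup.lift (Quotient.lift (s := isoSetoid A) F hiso)) (by
      rw [sliceRelations, AddSubgroup.closure_le]
      rintro _ ⟨M, U, V, h, rfl⟩
      simp only [SetLike.mem_coe, AddMonoidHom.mem_ker, map_sub, freeMk,
        FreeAbelianGroup.lift_apply_of]
      change F M - F (M.restrict U) - F (M.restrict V) = 0
      rw [hadd M U V h]
      abel)

@[simp] theorem lift_mk {B : Type*} [AddCommGroup B] (F : GSetHom A → B) (hiso) (hadd)
    (M : GSetHom A) : lift F hiso hadd (mk M) = F M := by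
  change FreeAbelianGroup.lift (Quotient.lift (s := isoSetoid A) F hiso) (freeMk M) = F M
  rw [freeMk, FreeAbelianGroup.lift_apply_of]
  rfl

theorem induction_on {p : SliceBurnside A → Prop} (x : SliceBurnside A)
    (hmk : ∀ M, p (mk M)) (hadd : ∀ x y, p x → p y → p (x + y))
    (hneg : ∀ x, p x → p (-x)) (hzero : p 0) : p x := by
  obtain ⟨y, rfl⟩ := QuotientAddGroup.mk'_surjective (sliceRelations A) x
  induction y using FreeAbelianGroup.induction_on with
  | zero => exact hzero
  | of q =>
    obtain ⟨M, rfl⟩ := Quotient.exists_rep q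
    exact hmk M
  | neg q h => rw [map_neg]; exact hneg _ h
  | add a b ha hb => rw [map_add]; exact hadd _ _ ha hb

theorem hom_ext {B : Type*} [AddCommGroup B] {F F' : SliceBurnside A →+ B}
    (h : ∀ M, F (mk M) = F' (mk M)) : F = F' := by
  ext x
  induction x using induction_on with
  | hmk M => exact h M
  | hadd x y hx hy => rw [map_add, map_add, hx, hy]
  | hneg x hx => rw [map_neg, map_neg, hx]
  | hzero => rw [map_zero, map_zero]

/-- The whole of `X`. -/
def univSub (M : GSetHom A) : SubMulAction A M.X := ⟨Set.univ, fun _ _ _ => trivial⟩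

/-- The empty part of `X`. -/
def emptySub (M : GSetHom A) : SubMulAction A M.X := ⟨∅, fun _ _ h => h⟩

theorem mk_eq_zero_of_isEmpty (M : GSetHom A) [IsEmpty M.X] [IsEmpty M.Y] : mk M = 0 := by
  have h := mk_eq_restrict_add M (emptySub M) (emptySub M)
    ⟨fun s hs _ x => isEmptyElim x, fun s _ _ x => isEmptyElim x⟩
  have h1 : mk (M.restrict (emptySub M)) = mk M := by
    apply mk_eq_of_iso
    refine ⟨⟨fun x => x.1, fun _ _ => rfl⟩, ⟨fun x => x.1, fun _ _ => rfl⟩, ?_, ?_, fun _ => rfl⟩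
    · exact ⟨fun x => isEmptyElim x.1, fun x => isEmptyElim x⟩
    · exact ⟨fun x => isEmptyElim x.1, fun x => isEmptyElim x⟩
  rw [h1] at h
  simpa using h

theorem mk_restrict_univ (M : GSetHom A) : mk (M.restrict (univSub M)) = mk M := by
  have h := mk_eq_restrict_add M (univSub M) (emptySub M) isCompl_top_bot
  have : IsEmpty (M.restrict (emptySub M)).X := ⟨fun x => x.2⟩
  have : IsEmpty (M.restrict (emptySub M)).Y := ⟨fun y => by
    obtain ⟨_, _, h, _⟩ := y
    exact h⟩
  rw [mk_eq_zero_of_isEmpty (M.restrict (emptySub M)), add_zero] at h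
  exact h.symm

theorem mk_eq_of_inj {M N : GSetHom A} (α : M.X →[A] N.X) (β : M.Y →[A] N.Y)
    (hα : Function.Bijective α) (hβ : Function.Injective β)
    (h : ∀ x, β (M.toHom x) = N.toHom (α x)) : mk M = mk N := by
  rw [← mk_restrict_univ M, ← mk_restrict_univ N]
  apply mk_eq_of_iso
  refine ⟨⟨fun x => ⟨α x.1, trivial⟩, fun a x => Subtype.ext (map_smul α a x.1)⟩,
    ⟨fun y => ⟨β y.1, ?_⟩, fun a y => Subtype.ext (map_smul β a y.1)⟩, ?_, ?_, ?_⟩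
  · obtain ⟨_, x, _, rfl⟩ := y
    exact ⟨α x, trivial, (h x).symm⟩
  · constructor
    · rintro ⟨x, hx⟩ ⟨y, hy⟩ hxy
      exact Subtype.ext (hα.1 (congrArg Subtype.val hxy))
    · rintro ⟨y, hy⟩
      obtain ⟨x, rfl⟩ := hα.2 y
      exact ⟨⟨x, trivial⟩, rfl⟩
  · constructor
    · rintro ⟨x, hx⟩ ⟨y, hy⟩ hxy
      exact Subtype.ext (hβ (congrArg Subtype.val hxy))
    · rintro ⟨_, z, _, rfl⟩
      obtain ⟨x, rfl⟩ := hα.2 z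
      exact ⟨⟨M.toHom x, x, trivial, rfl⟩, Subtype.ext (h x)⟩
  · rintro ⟨x, hx⟩
    exact Subtype.ext (h x)

/-- The restriction of `f : X → Y` to `U`, with target `Y`. -/
def GSetHom.dom (M : GSetHom A) (U : SubMulAction A M.X) : GSetHom A where
  X := U
  Y := M.Y
  toHom := ⟨fun x => M.toHom x.1, fun a x => map_smul M.toHom a x.1⟩

theorem mk_restrict (M : GSetHom A) (U : SubMulAction A M.X) :
    mk (M.restrict U) = mk (M.dom U) :=
  mk_eq_of_inj (M := M.restrict U) (N := M.dom U) (MulActionHom.id A)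
    ⟨fun y => y.1, fun _ _ => rfl⟩
    Function.bijective_id Subtype.val_injective (fun _ => rfl)

/-- The range of a morphism of `A`-sets. -/
def rangeSub {X Y : Type u} [MulAction A X] [MulAction A Y] (α : X →[A] Y) :
    SubMulAction A Y where
  carrier := Set.range α
  smul_mem' := by
    rintro a _ ⟨x, rfl⟩
    exact ⟨a • x, map_smul α a x⟩

theorem mk_eq_restrict_range {M N : GSetHom A} (α : M.X →[A] N.X) (β : M.Y →[A] N.Y)
    (hα : Function.Injective α) (hβ : Function.Injective β)
    (h : ∀ x, β (M.toHom x) = N.toHom (α x)) : mk M = mk (N.restrict (rangeSub α)) := by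
  rw [mk_restrict]
  refine mk_eq_of_inj (N := N.dom (rangeSub α))
    ⟨fun x => ⟨α x, x, rfl⟩, fun a x => Subtype.ext (map_smul α a x)⟩ β ?_ hβ h
  constructor
  · intro x y hxy
    exact hα (congrArg Subtype.val hxy)
  · rintro ⟨_, x, rfl⟩
    exact ⟨x, rfl⟩

theorem mk_eq_add {M M₁ M₂ : GSetHom A} (α₁ : M₁.X →[A] M.X) (α₂ : M₂.X →[A] M.X)
    (β₁ : M₁.Y →[A] M.Y) (β₂ : M₂.Y →[A] M.Y)
    (hα₁ : Function.Injective α₁) (hα₂ : Function.Injective α₂)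
    (hβ₁ : Function.Injective β₁) (hβ₂ : Function.Injective β₂)
    (h₁ : ∀ x, β₁ (M₁.toHom x) = M.toHom (α₁ x)) (h₂ : ∀ x, β₂ (M₂.toHom x) = M.toHom (α₂ x))
    (hd : ∀ x y, α₁ x ≠ α₂ y) (hc : ∀ z, (∃ x, α₁ x = z) ∨ ∃ y, α₂ y = z) :
    mk M = mk M₁ + mk M₂ := by
  rw [mk_eq_restrict_range α₁ β₁ hα₁ hβ₁ h₁, mk_eq_restrict_range α₂ β₂ hα₂ hβ₂ h₂]
  apply mk_eq_restrict_add
  constructor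
  · rw [Set.disjoint_left]
    rintro _ ⟨x, rfl⟩ ⟨y, hy⟩
    exact hd x y hy.symm
  · rw [codisjoint_iff_le_sup]
    intro z _
    exact hc z

/-- The underlying set of `n` copies of an `A`-set. -/
def CopiesX (n : ℕ) (X : Type u) : Type u := Fin n × X

instance (n : ℕ) (X : Type u) [Finite X] : Finite (CopiesX n X) :=
  inferInstanceAs (Finite (Fin n × X))

instance (n : ℕ) (X : Type u) [MulAction A X] : MulAction A (CopiesX n X) where
  smul a p := (p.1, a • p.2)
  one_smul p := Prod.ext rfl (one_smul A p.2)
  mul_smul a b p := Prod.ext rfl (mul_smul a b p.2)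

/-- The disjoint union of `n` copies of `X`, mapped to `Y` by `f` on each copy. -/
def copies (M : GSetHom A) (n : ℕ) : GSetHom A where
  X := CopiesX n M.X
  Y := M.Y
  toHom := ⟨fun p => M.toHom p.2, fun a p => map_smul M.toHom a p.2⟩

theorem mk_copies (M : GSetHom A) (n : ℕ) : mk (copies M n) = n • mk M := by
  induction n with
  | zero =>
    have : IsEmpty (copies M 0).X := ⟨fun p => Fin.elim0 p.1⟩
    have h : mk (copies M 0) = mk (copies M 0) + mk (copies M 0) :=
      mk_eq_add (MulActionHom.id A) (MulActionHom.id A) (MulActionHom.id A) (MulActionHom.id A)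
        Function.injective_id Function.injective_id Function.injective_id Function.injective_id
        (fun _ => rfl) (fun _ => rfl) (fun x => isEmptyElim x) (fun x => isEmptyElim x)
    simpa using h
  | succ n ih =>
    rw [succ_nsmul, ← ih]
    refine mk_eq_add (M := copies M (n + 1)) (M₁ := copies M n) (M₂ := M)
      ⟨fun p => (p.1.castSucc, p.2), fun _ _ => rfl⟩ ⟨fun x => (Fin.last n, x), fun _ _ => rfl⟩
      (MulActionHom.id A) (MulActionHom.id A) ?_ ?_ Function.injective_id Function.injective_id
      (fun _ => rfl) (fun _ => rfl) ?_ ?_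
    · rintro ⟨i, x⟩ ⟨j, y⟩ h
      have h1 := congrArg Prod.fst h
      have h2 := congrArg Prod.snd h
      exact Prod.ext (Fin.castSucc_injective n h1) h2
    · intro x y h
      exact congrArg Prod.snd h
    · rintro ⟨i, x⟩ y h
      exact (Fin.castSucc_lt_last i).ne (congrArg Prod.fst h)
    · rintro ⟨i, x⟩
      induction i using Fin.lastCases with
      | last => exact Or.inr ⟨x, rfl⟩
      | cast i => exact Or.inl ⟨(i, x), rfl⟩

theorem mk_eq_card_smul {M N : GSetHom A} {ι : Type*} [Finite ι] (α : ι → M.X →[A] N.X)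
    (β : M.Y →[A] N.Y) (hα : Function.Bijective (fun p : ι × M.X => α p.1 p.2))
    (hβ : Function.Injective β) (h : ∀ i x, β (M.toHom x) = N.toHom (α i x)) :
    mk N = Nat.card ι • mk M := by
  rw [← mk_copies]
  symm
  let e := Finite.equivFin ι
  refine mk_eq_of_inj (M := copies M (Nat.card ι)) (N := N)
    ⟨fun p => α (e.symm p.1) p.2, fun a p => map_smul (α (e.symm p.1)) a p.2⟩ β ?_ hβ
    (fun p => h (e.symm p.1) p.2)
  exact hα.comp ((e.symm.prodCongr (Equiv.refl M.X)).bijective)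

end Slice
/-! ### Composition of biset morphisms -/

section Composition

variable {G H K L : Type u} [Group G] [Group H] [Group K] [Group L]

/-- A `(G × H)`-set `X` is a `(G, H)`-biset via `g · x · h = (g, h⁻¹) • x`. The product `X ×_H X'`
is the quotient of `X × X'` by the relation `(x, x') ~ (x · h⁻¹, h · x')`. -/
def amalgSetoid (G H K : Type u) [Group G] [Group H] [Group K] (X X' : Type u)
    [MulAction (G × H) X] [MulAction (H × K) X'] : Setoid (X × X') where
  r p q := ∃ h : H, ((1, h) : G × H) • p.1 = q.1 ∧ ((h, 1) : H × K) • p.2 = q.2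
  iseqv :=
    { refl := fun p => ⟨1, one_smul _ p.1, one_smul _ p.2⟩
      symm := by
        rintro p q ⟨h, h1, h2⟩
        refine ⟨h⁻¹, ?_, ?_⟩
        · rw [← h1, smul_smul]
          simp [← Prod.one_eq_mk]
        · rw [← h2, smul_smul]
          simp [← Prod.one_eq_mk]
      trans := by
        rintro p q r ⟨h, h1, h2⟩ ⟨h', h3, h4⟩
        refine ⟨h' * h, ?_, ?_⟩
        · rw [← h3, ← h1, smul_smul]
          simp
        · rw [← h4, ← h2, smul_smul]
          simp }

/-- The amalgamated product `X ×_H X'`. -/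
def Amalg (G H K : Type u) [Group G] [Group H] [Group K] (X X' : Type u)
    [MulAction (G × H) X] [MulAction (H × K) X'] : Type u :=
  Quotient (amalgSetoid G H K X X')

section Amalg

variable {X X' Y Y' : Type u} [MulAction (G × H) X] [MulAction (H × K) X']
  [MulAction (G × H) Y] [MulAction (H × K) Y']

/-- The class of `(x, x')` in `X ×_H X'`. -/
def tmk (G H K : Type u) [Group G] [Group H] [Group K] {X X' : Type u}
    [MulAction (G × H) X] [MulAction (H × K) X'] (x : X) (x' : X') : Amalg G H K X X' :=
  Quotient.mk (amalgSetoid G H K X X') (x, x')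

theorem tmk_eq {x y : X} {x' y' : X'} : tmk G H K x x' = tmk G H K y y' ↔
    ∃ h : H, ((1, h) : G × H) • x = y ∧ ((h, 1) : H × K) • x' = y' :=
  Quotient.eq (r := amalgSetoid G H K X X')

theorem tmk_surj (z : Amalg G H K X X') : ∃ x x', tmk G H K x x' = z := by
  obtain ⟨⟨x, x'⟩, rfl⟩ := Quotient.exists_rep z
  exact ⟨x, x', rfl⟩

/-- Maps out of `X ×_H X'`. -/
def tlift {B : Sort*} (F : X → X' → B)
    (hF : ∀ (h : H) x x', F x x' = F (((1, h) : G × H) • x) (((h, 1) : H × K) • x')) :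
    Amalg G H K X X' → B :=
  Quotient.lift (s := amalgSetoid G H K X X') (fun p => F p.1 p.2) (by
    rintro ⟨x, x'⟩ ⟨y, y'⟩ ⟨h, h1, h2⟩
    dsimp only at h1 h2 ⊢
    rw [hF h, h1, h2])

@[simp] theorem tlift_tmk {B : Sort*} (F : X → X' → B) (hF) (x : X) (x' : X') :
    tlift (G := G) (H := H) (K := K) F hF (tmk G H K x x') = F x x' := rfl

instance [Finite X] [Finite X'] : Finite (Amalg G H K X X') :=
  inferInstanceAs (Finite (Quotient (amalgSetoid G H K X X')))

/-- `X ×_H X'` is a `(G × K)`-set via `(g, k) • (x, x') = ((g, 1) • x, (1, k) • x')`. -/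
instance : MulAction (G × K) (Amalg G H K X X') where
  smul a := tlift (fun x x' => tmk G H K (((a.1, 1) : G × H) • x) (((1, a.2) : H × K) • x')) (by
    intro h x x'
    rw [tmk_eq]
    refine ⟨h, ?_, ?_⟩ <;> simp [smul_smul])
  one_smul z := by
    obtain ⟨x, x', rfl⟩ := tmk_surj z
    change tmk G H K (((1, 1) : G × H) • x) (((1, 1) : H × K) • x') = _
    rw [← Prod.one_eq_mk, ← Prod.one_eq_mk, one_smul, one_smul]
  mul_smul a b z := by
    obtain ⟨x, x', rfl⟩ := tmk_surj z
    change tmk G H K (((a.1 * b.1, 1) : G × H) • x) (((1, a.2 * b.2) : H × K) • x') =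
      tmk G H K (((a.1, 1) : G × H) • ((b.1, 1) : G × H) • x)
        (((1, a.2) : H × K) • ((1, b.2) : H × K) • x')
    simp [smul_smul]

theorem smul_tmk (a : G × K) (x : X) (x' : X') : a • tmk G H K x x' =
    tmk G H K (((a.1, 1) : G × H) • x) (((1, a.2) : H × K) • x') := rfl

/-- The map `f ×_H f'`. -/
def amalgMap (f : X →[G × H] Y) (f' : X' →[H × K] Y') :
    Amalg G H K X X' →[G × K] Amalg G H K Y Y' where
  toFun := tlift (fun x x' => tmk G H K (f x) (f' x')) (by
    intro h x x'
    rw [tmk_eq]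
    exact ⟨h, (map_smul f _ _).symm, (map_smul f' _ _).symm⟩)
  map_smul' a z := by
    obtain ⟨x, x', rfl⟩ := tmk_surj z
    rw [smul_tmk, tlift_tmk, tlift_tmk, id, smul_tmk, map_smul, map_smul]

@[simp] theorem amalgMap_tmk (f : X →[G × H] Y) (f' : X' →[H × K] Y') (x : X) (x' : X') :
    amalgMap f f' (tmk G H K x x') = tmk G H K (f x) (f' x') := rfl

theorem amalgMap_injective (f : X →[G × H] Y) (f' : X' →[H × K] Y')
    (hf : Function.Injective f) (hf' : Function.Injective f') :
    Function.Injective (amalgMap f f') := by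
  intro z w h
  obtain ⟨x, x', rfl⟩ := tmk_surj z
  obtain ⟨y, y', rfl⟩ := tmk_surj w
  rw [amalgMap_tmk, amalgMap_tmk, tmk_eq] at h
  obtain ⟨c, h1, h2⟩ := h
  rw [tmk_eq]
  exact ⟨c, hf (by rw [map_smul, h1]), hf' (by rw [map_smul, h2])⟩

theorem amalgMap_surjective (f : X →[G × H] Y) (f' : X' →[H × K] Y')
    (hf : Function.Surjective f) (hf' : Function.Surjective f') :
    Function.Surjective (amalgMap f f') := by
  intro z
  obtain ⟨y, y', rfl⟩ := tmk_surj z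
  obtain ⟨x, rfl⟩ := hf y
  obtain ⟨x', rfl⟩ := hf' y'
  exact ⟨tmk G H K x x', rfl⟩

end Amalg

/-- The composition `f ×_H f' : X ×_H X' → Y ×_H Y'`. -/
def GSetHom.comp (M : GSetHom (G × H)) (N : GSetHom (H × K)) : GSetHom (G × K) where
  X := Amalg G H K M.X N.X
  Y := Amalg G H K M.Y N.Y
  toHom := amalgMap M.toHom N.toHom

theorem mk_comp_congr {M M' : GSetHom (G × H)} {N N' : GSetHom (H × K)}
    (hM : M.Iso M') (hN : N.Iso N') : mk (M.comp N) = mk (M'.comp N') := by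
  obtain ⟨α, β, hα, hβ, h⟩ := hM
  obtain ⟨α', β', hα', hβ', h'⟩ := hN
  refine mk_eq_of_inj (M := M.comp N) (N := M'.comp N') (amalgMap α α') (amalgMap β β')
    ⟨amalgMap_injective _ _ hα.1 hα'.1, amalgMap_surjective _ _ hα.2 hα'.2⟩
    (amalgMap_injective _ _ hβ.1 hβ'.1) ?_
  intro z
  obtain ⟨x, x', rfl⟩ := tmk_surj z
  change tmk G H K (β (M.toHom x)) (β' (N.toHom x')) =
    tmk G H K (M'.toHom (α x)) (N'.toHom (α' x'))
  rw [h, h']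

theorem GSetHom.Iso.refl {A : Type u} [Group A] (M : GSetHom A) : M.Iso M :=
  (isoSetoid A).iseqv.refl M

/-- The inclusion of a sub-`A`-set. -/
def subIncl {A : Type u} [Group A] {X : Type u} [MulAction A X] (U : SubMulAction A X) :
    U →[A] X := ⟨fun x => x.1, fun _ _ => rfl⟩

theorem mk_comp_add_left (M : GSetHom (G × H)) (N : GSetHom (H × K))
    (U V : SubMulAction (G × H) M.X) (hUV : IsCompl (U : Set M.X) (V : Set M.X)) :
    mk (M.comp N) = mk ((M.restrict U).comp N) + mk ((M.restrict V).comp N) := by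
  refine mk_eq_add (M := M.comp N) (M₁ := (M.restrict U).comp N) (M₂ := (M.restrict V).comp N)
    (amalgMap (subIncl U) (MulActionHom.id _)) (amalgMap (subIncl V) (MulActionHom.id _))
    (amalgMap (subIncl _) (MulActionHom.id _)) (amalgMap (subIncl _) (MulActionHom.id _))
    (amalgMap_injective _ _ Subtype.val_injective Function.injective_id)
    (amalgMap_injective _ _ Subtype.val_injective Function.injective_id)
    (amalgMap_injective _ _ Subtype.val_injective Function.injective_id)
    (amalgMap_injective _ _ Subtype.val_injective Function.injective_id) ?_ ?_ ?_ ?_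
  · intro z
    obtain ⟨x, x', rfl⟩ := tmk_surj z
    rfl
  · intro z
    obtain ⟨x, x', rfl⟩ := tmk_surj z
    rfl
  · intro z w h
    obtain ⟨x, x', rfl⟩ := tmk_surj z
    obtain ⟨y, y', rfl⟩ := tmk_surj w
    obtain ⟨c, h1, -⟩ := tmk_eq.1 (show tmk G H K x.1 x' = tmk G H K y.1 y' from h)
    exact Set.disjoint_left.1 hUV.1 (h1 ▸ U.smul_mem _ x.2 : y.1 ∈ U) y.2
  · intro z
    obtain ⟨x, x', rfl⟩ := tmk_surj z
    have hx : x ∈ (U : Set M.X) ∪ V := (codisjoint_iff_le_sup.1 hUV.2) (Set.mem_univ x)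
    rcases hx with hx | hx
    · exact Or.inl ⟨tmk G H K ⟨x, hx⟩ x', rfl⟩
    · exact Or.inr ⟨tmk G H K ⟨x, hx⟩ x', rfl⟩

theorem mk_comp_add_right (M : GSetHom (G × H)) (N : GSetHom (H × K))
    (U V : SubMulAction (H × K) N.X) (hUV : IsCompl (U : Set N.X) (V : Set N.X)) :
    mk (M.comp N) = mk (M.comp (N.restrict U)) + mk (M.comp (N.restrict V)) := by
  refine mk_eq_add (M := M.comp N) (M₁ := M.comp (N.restrict U)) (M₂ := M.comp (N.restrict V))
    (amalgMap (MulActionHom.id _) (subIncl U)) (amalgMap (MulActionHom.id _) (subIncl V))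
    (amalgMap (MulActionHom.id _) (subIncl _)) (amalgMap (MulActionHom.id _) (subIncl _))
    (amalgMap_injective _ _ Function.injective_id Subtype.val_injective)
    (amalgMap_injective _ _ Function.injective_id Subtype.val_injective)
    (amalgMap_injective _ _ Function.injective_id Subtype.val_injective)
    (amalgMap_injective _ _ Function.injective_id Subtype.val_injective) ?_ ?_ ?_ ?_
  · intro z
    obtain ⟨x, x', rfl⟩ := tmk_surj z
    rfl
  · intro z
    obtain ⟨x, x', rfl⟩ := tmk_surj z
    rfl
  · intro z w h
    obtain ⟨x, x', rfl⟩ := tmk_surj z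
    obtain ⟨y, y', rfl⟩ := tmk_surj w
    obtain ⟨c, -, h1⟩ := tmk_eq.1 (show tmk G H K x x'.1 = tmk G H K y y'.1 from h)
    exact Set.disjoint_left.1 hUV.1 (h1 ▸ U.smul_mem _ x'.2 : y'.1 ∈ U) y'.2
  · intro z
    obtain ⟨x, x', rfl⟩ := tmk_surj z
    have hx : x' ∈ (U : Set N.X) ∪ V := (codisjoint_iff_le_sup.1 hUV.2) (Set.mem_univ x')
    rcases hx with hx | hx
    · exact Or.inl ⟨tmk G H K x ⟨x', hx⟩, rfl⟩
    · exact Or.inr ⟨tmk G H K x ⟨x', hx⟩, rfl⟩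

/-- Composition `Ξ(G × H) × Ξ(H × K) → Ξ(G × K)`, induced by `(f, f') ↦ f ×_H f'`. -/
def compHom (G H K : Type u) [Group G] [Group H] [Group K] :
    SliceBurnside (G × H) →+ SliceBurnside (H × K) →+ SliceBurnside (G × K) :=
  lift
    (fun M => lift (fun N => mk (M.comp N))
      (fun _ _ h => mk_comp_congr (GSetHom.Iso.refl M) h)
      (fun N U V h => mk_comp_add_right M N U V h))
    (fun M M' h => hom_ext fun N => by
      rw [lift_mk, lift_mk]
      exact mk_comp_congr h (GSetHom.Iso.refl N))
    (fun M U V h => hom_ext fun N => by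
      rw [AddMonoidHom.add_apply, lift_mk, lift_mk, lift_mk]
      exact mk_comp_add_left M N U V h)

theorem compHom_mk (M : GSetHom (G × H)) (N : GSetHom (H × K)) :
    compHom G H K (mk M) (mk N) = mk (M.comp N) := by
  rw [compHom, lift_mk, lift_mk]

/-- The associativity map `(X ×_H X') ×_K X'' → X ×_H (X' ×_K X'')`. -/
def amalgAssoc {X X' X'' : Type u} [MulAction (G × H) X] [MulAction (H × K) X']
    [MulAction (K × L) X''] :
    Amalg G K L (Amalg G H K X X') X'' →[G × L] Amalg G H L X (Amalg H K L X' X'') where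
  toFun := tlift (fun z x'' => tlift (fun x x' => tmk G H L x (tmk H K L x' x'')) (by
      intro h x x'
      rw [tmk_eq]
      refine ⟨h, rfl, ?_⟩
      rw [smul_tmk]
      simp only [← Prod.one_eq_mk, one_smul]) z) (by
    intro c z x''
    obtain ⟨x, x', rfl⟩ := tmk_surj z
    rw [smul_tmk, tlift_tmk, tlift_tmk]
    simp only [← Prod.one_eq_mk, one_smul]
    congr 1
    rw [tmk_eq]
    exact ⟨c, rfl, rfl⟩)
  map_smul' a w := by
    obtain ⟨z, x'', rfl⟩ := tmk_surj w
    obtain ⟨x, x', rfl⟩ := tmk_surj z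
    simp only [smul_tmk, tlift_tmk, id, ← Prod.one_eq_mk, one_smul]

@[simp] theorem amalgAssoc_tmk {X X' X'' : Type u} [MulAction (G × H) X] [MulAction (H × K) X']
    [MulAction (K × L) X''] (x : X) (x' : X') (x'' : X'') :
    amalgAssoc (tmk G K L (tmk G H K x x') x'') = tmk G H L x (tmk H K L x' x'') := rfl

theorem amalgAssoc_bijective {X X' X'' : Type u} [MulAction (G × H) X] [MulAction (H × K) X']
    [MulAction (K × L) X''] :
    Function.Bijective (amalgAssoc (G := G) (H := H) (K := K) (L := L)
      (X := X) (X' := X') (X'' := X'')) := by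
  constructor
  · intro z w h
    obtain ⟨z, x'', rfl⟩ := tmk_surj z
    obtain ⟨x, x', rfl⟩ := tmk_surj z
    obtain ⟨w, y'', rfl⟩ := tmk_surj w
    obtain ⟨y, y', rfl⟩ := tmk_surj w
    rw [amalgAssoc_tmk, amalgAssoc_tmk, tmk_eq] at h
    obtain ⟨h, h1, h2⟩ := h
    rw [smul_tmk, tmk_eq] at h2
    obtain ⟨c, h3, h4⟩ := h2
    simp only [← Prod.one_eq_mk, one_smul] at h4
    rw [tmk_eq]
    refine ⟨c, ?_, h4⟩
    rw [smul_tmk, tmk_eq]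
    refine ⟨h, ?_, ?_⟩
    · simp only [← Prod.one_eq_mk, one_smul, h1]
    · rw [← h3]
      simp [smul_smul]
  · intro z
    obtain ⟨x, w, rfl⟩ := tmk_surj z
    obtain ⟨x', x'', rfl⟩ := tmk_surj w
    exact ⟨tmk G K L (tmk G H K x x') x'', rfl⟩

theorem compHom_assoc (a : SliceBurnside (G × H)) (b : SliceBurnside (H × K))
    (c : SliceBurnside (K × L)) :
    compHom G K L (compHom G H K a b) c = compHom G H L a (compHom H K L b c) := by
  induction a using induction_on with
  | hadd x y hx hy => simp only [map_add, AddMonoidHom.add_apply, hx, hy]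
  | hneg x hx => simp only [map_neg, AddMonoidHom.neg_apply, hx]
  | hzero => simp only [map_zero, AddMonoidHom.zero_apply]
  | hmk M =>
  induction b using induction_on with
  | hadd x y hx hy => simp only [map_add, AddMonoidHom.add_apply, hx, hy]
  | hneg x hx => simp only [map_neg, AddMonoidHom.neg_apply, hx]
  | hzero => simp only [map_zero, AddMonoidHom.zero_apply]
  | hmk N =>
  induction c using induction_on with
  | hadd x y hx hy => simp only [map_add, hx, hy]
  | hneg x hx => simp only [map_neg, hx]
  | hzero => simp only [map_zero]
  | hmk P =>
  simp only [compHom_mk]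
  refine mk_eq_of_inj (M := (M.comp N).comp P) (N := M.comp (N.comp P))
    amalgAssoc amalgAssoc amalgAssoc_bijective amalgAssoc_bijective.1 ?_
  intro z
  obtain ⟨z, x'', rfl⟩ := tmk_surj z
  obtain ⟨x, x', rfl⟩ := tmk_surj z
  rfl

/-- Compositions of Galois morphisms are Galois morphisms. -/
theorem GSetHom.IsGalois.comp {M : GSetHom (G × H)} {N : GSetHom (H × K)}
    (hM : M.IsGalois) (hN : N.IsGalois) : (M.comp N).IsGalois := by
  intro z w h
  obtain ⟨x, x', rfl⟩ := tmk_surj z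
  obtain ⟨y, y', rfl⟩ := tmk_surj w
  change tmk G H K (M.toHom x) (N.toHom x') = tmk G H K (M.toHom y) (N.toHom y') at h
  rw [tmk_eq] at h
  obtain ⟨c, h1, h2⟩ := h
  obtain ⟨φ, hφ, h3, h4⟩ := hM (((1, c) : G × H) • x) y (by rw [map_smul, h1])
  obtain ⟨ψ, hψ, h5, h6⟩ := hN (((c, 1) : H × K) • x') y' (by rw [map_smul, h2])
  refine ⟨amalgMap φ ψ, ⟨amalgMap_injective _ _ hφ.1 hψ.1, amalgMap_surjective _ _ hφ.2 hψ.2⟩,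
    ?_, ?_⟩
  · intro z
    obtain ⟨a, a', rfl⟩ := tmk_surj z
    change tmk G H K (M.toHom (φ a)) (N.toHom (ψ a')) = tmk G H K (M.toHom a) (N.toHom a')
    rw [h3, h5]
  · change tmk G H K (φ x) (ψ x') = tmk G H K y y'
    rw [tmk_eq]
    refine ⟨c, ?_, ?_⟩
    · rw [← h4, map_smul]
    · rw [← h6, map_smul]

end Composition
/-! ### Sections of groups -/

/-- A section `(T, S)` of `A`: subgroups `S ⊴ T ≤ A`. -/
@[ext] structure GroupSection (A : Type u) [Group A] where
  T : Subgroup A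
  S : Subgroup A
  le : S ≤ T
  normal : (S.subgroupOf T).Normal

section Sections

variable {A : Type u} [Group A]

theorem GroupSection.conj_mem (σ : GroupSection A) {t s : A} (ht : t ∈ σ.T) (hs : s ∈ σ.S) :
    t * s * t⁻¹ ∈ σ.S :=
  σ.normal.conj_mem ⟨s, σ.le hs⟩ hs ⟨t, ht⟩

/-- Build a section from conjugation-invariance. -/
def GroupSection.ofConj (T S : Subgroup A) (le : S ≤ T)
    (h : ∀ t ∈ T, ∀ s ∈ S, t * s * t⁻¹ ∈ S) : GroupSection A where
  T := T
  S := S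
  le := le
  normal := ⟨fun n hn g => h g.1 g.2 n.1 hn⟩

/-- The projection `A/S → A/T` of a section `(T, S)`, as a morphism of `A`-sets. -/
def GroupSection.toGSetHom [Finite A] (σ : GroupSection A) : GSetHom A where
  X := A ⧸ σ.S
  Y := A ⧸ σ.T
  toHom :=
    { toFun := Subgroup.quotientMapOfLE σ.le
      map_smul' := by
        intro a x
        induction x using QuotientGroup.induction_on
        rfl }

/-- The equivariant map `A/B → X` sending `aB` to `a • x`, for `x` fixed by `B`. -/
def orbitMap {X : Type u} [MulAction A X] (B : Subgroup A) (x : X) (hx : ∀ b ∈ B, b • x = x) :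
    A ⧸ B →[A] X where
  toFun := fun q => Quotient.liftOn' q (fun a => a • x) (by
    intro a b hab
    have h := hx _ (QuotientGroup.leftRel_apply.1 hab)
    rw [mul_smul, inv_smul_eq_iff] at h
    exact h.symm)
  map_smul' := by
    intro a q
    induction q using QuotientGroup.induction_on
    exact mul_smul _ _ _

theorem orbitMap_mk {X : Type u} [MulAction A X] (B : Subgroup A) (x : X)
    (hx : ∀ b ∈ B, b • x = x) (a : A) : orbitMap B x hx (a : A ⧸ B) = a • x := rfl

theorem GroupSection.isGalois [Finite A] (σ : GroupSection A) : σ.toGSetHom.IsGalois := by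
  intro x x' h
  obtain ⟨a, rfl⟩ := QuotientGroup.mk_surjective (s := σ.S) x
  obtain ⟨b, rfl⟩ := QuotientGroup.mk_surjective (s := σ.S) x'
  have h0 : (a : A ⧸ σ.T) = b := h
  have ht : a⁻¹ * b ∈ σ.T := QuotientGroup.eq.1 h0
  have key : ∀ t ∈ σ.T, ∀ s ∈ σ.S, s • (t : A ⧸ σ.S) = (t : A ⧸ σ.S) := by
    intro t ht s hs
    change ((s * t : A) : A ⧸ σ.S) = t
    refine QuotientGroup.eq.2 ?_
    have := σ.conj_mem (σ.T.inv_mem ht) (σ.S.inv_mem hs)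
    simpa [mul_assoc] using this
  refine ⟨orbitMap σ.S ((a⁻¹ * b : A) : A ⧸ σ.S) (key _ ht), ⟨?_, ?_⟩, ?_, ?_⟩
  · intro x y hxy
    induction x using QuotientGroup.induction_on with | H c =>
    induction y using QuotientGroup.induction_on with | H d =>
    have h1 : ((c * (a⁻¹ * b) : A) : A ⧸ σ.S) = (d * (a⁻¹ * b) : A) := hxy
    have h2 := QuotientGroup.eq.1 h1
    refine QuotientGroup.eq.2 ?_
    have := σ.conj_mem ht h2
    simpa [mul_assoc] using this
  · intro y
    induction y using QuotientGroup.induction_on with | H d =>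
    refine ⟨((d * (a⁻¹ * b)⁻¹ : A) : A ⧸ σ.S), ?_⟩
    change ((d * (a⁻¹ * b)⁻¹ * (a⁻¹ * b) : A) : A ⧸ σ.S) = d
    rw [inv_mul_cancel_right]
  · intro z
    induction z using QuotientGroup.induction_on with | H d =>
    change ((d * (a⁻¹ * b) : A) : A ⧸ σ.T) = d
    refine QuotientGroup.eq.2 ?_
    simpa [mul_assoc] using σ.T.inv_mem ht
  · change ((a * (a⁻¹ * b) : A) : A ⧸ σ.S) = b
    rw [mul_inv_cancel_left]

variable (A) in
/-- The section Burnside ring `Γ(A)` as a subgroup of `Ξ(A)`: the subgroup generated by the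
classes of the Galois morphisms. (Direct products of Galois morphisms are Galois, so this is
also the subring of the slice Burnside ring that they generate.) -/
def sectionBurnside : AddSubgroup (SliceBurnside A) :=
  AddSubgroup.closure { a | ∃ M : GSetHom A, M.IsGalois ∧ a = mk M }

end Sections

section Product

variable {G H K : Type u} [Group G] [Group H] [Group K]

/-- The projection `p₁(U) = {g | (g, h) ∈ U for some h}`. -/
def p₁ (U : Subgroup (G × H)) : Subgroup G := U.map (MonoidHom.fst G H)

/-- The projection `p₂(U) = {h | (g, h) ∈ U for some g}`. -/
def p₂ (U : Subgroup (G × H)) : Subgroup H := U.map (MonoidHom.snd G H)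

/-- The kernel `k₁(U) = {g | (g, 1) ∈ U}`. -/
def k₁ (U : Subgroup (G × H)) : Subgroup G := U.comap (MonoidHom.inl G H)

/-- The kernel `k₂(U) = {h | (1, h) ∈ U}`. -/
def k₂ (U : Subgroup (G × H)) : Subgroup H := U.comap (MonoidHom.inr G H)

theorem mem_p₁ {U : Subgroup (G × H)} {g : G} : g ∈ p₁ U ↔ ∃ h, (g, h) ∈ U := by
  simp [p₁, Subgroup.mem_map]

theorem mem_p₂ {U : Subgroup (G × H)} {h : H} : h ∈ p₂ U ↔ ∃ g, (g, h) ∈ U := by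
  simp [p₂, Subgroup.mem_map]

theorem mem_k₁ {U : Subgroup (G × H)} {g : G} : g ∈ k₁ U ↔ (g, 1) ∈ U := Iff.rfl

theorem mem_k₂ {U : Subgroup (G × H)} {h : H} : h ∈ k₂ U ↔ (1, h) ∈ U := Iff.rfl

/-- The left invariant `l(T, S) = (p₁(T), k₁(T), p₁(S), k₁(S))`. -/
def leftInv (σ : GroupSection (G × H)) :
    Subgroup G × Subgroup G × Subgroup G × Subgroup G :=
  (p₁ σ.T, k₁ σ.T, p₁ σ.S, k₁ σ.S)

/-- The right invariant `r(T, S) = (p₂(T), k₂(T), p₂(S), k₂(S))`. -/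
def rightInv (σ : GroupSection (G × H)) :
    Subgroup H × Subgroup H × Subgroup H × Subgroup H :=
  (p₂ σ.T, k₂ σ.T, p₂ σ.S, k₂ σ.S)

/-- A section `(T, S)` of `G × H` is covering if `p₁(T) = G`, `p₂(T) = H`, `k₁(S) = 1` and
`k₂(S) = 1`. -/
def IsCovering (σ : GroupSection (G × H)) : Prop :=
  p₁ σ.T = ⊤ ∧ p₂ σ.T = ⊤ ∧ k₁ σ.S = ⊥ ∧ k₂ σ.S = ⊥

theorem leftInv_eq_iff {σ : GroupSection (G × H)} {N P : Subgroup G} :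
    leftInv σ = (⊤, N, P, ⊥) ↔ p₁ σ.T = ⊤ ∧ k₁ σ.T = N ∧ p₁ σ.S = P ∧ k₁ σ.S = ⊥ := by
  simp [leftInv]

theorem rightInv_eq_iff {σ : GroupSection (G × H)} {N P : Subgroup H} :
    rightInv σ = (⊤, N, P, ⊥) ↔ p₂ σ.T = ⊤ ∧ k₂ σ.T = N ∧ p₂ σ.S = P ∧ k₂ σ.S = ⊥ := by
  simp [rightInv]

/-- The composition `S * U` of relations. -/
def star (S : Subgroup (G × H)) (U : Subgroup (H × K)) : Subgroup (G × K) where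
  carrier := { x | ∃ h, (x.1, h) ∈ S ∧ (h, x.2) ∈ U }
  one_mem' := ⟨1, S.one_mem, U.one_mem⟩
  mul_mem' := by
    rintro x y ⟨h, h1, h2⟩ ⟨h', h3, h4⟩
    exact ⟨h * h', S.mul_mem h1 h3, U.mul_mem h2 h4⟩
  inv_mem' := by
    rintro x ⟨h, h1, h2⟩
    exact ⟨h⁻¹, S.inv_mem h1, U.inv_mem h2⟩

theorem mem_star {S : Subgroup (G × H)} {U : Subgroup (H × K)} {x : G × K} :
    x ∈ star S U ↔ ∃ h, (x.1, h) ∈ S ∧ (h, x.2) ∈ U := Iff.rfl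

/-- The section `(T * V, S * U)`. -/
def GroupSection.star (σ : GroupSection (G × H)) (τ : GroupSection (H × K)) :
    GroupSection (G × K) :=
  GroupSection.ofConj (SectionBurnside.star σ.T τ.T) (SectionBurnside.star σ.S τ.S)
    (by
      rintro x ⟨h, h1, h2⟩
      exact ⟨h, σ.le h1, τ.le h2⟩)
    (by
      rintro t ⟨h, h1, h2⟩ s ⟨h', h3, h4⟩
      exact ⟨h * h' * h⁻¹, σ.conj_mem h1 h3, τ.conj_mem h2 h4⟩)

/-- The opposite section. -/
def GroupSection.op (σ : GroupSection (G × H)) : GroupSection (H × G) :=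
  GroupSection.ofConj (σ.T.comap (MulEquiv.prodComm (M := H) (N := G)).toMonoidHom)
    (σ.S.comap (MulEquiv.prodComm (M := H) (N := G)).toMonoidHom)
    (Subgroup.comap_mono σ.le)
    (fun _ ht _ hs => σ.conj_mem (t := (_, _)) (s := (_, _)) ht hs)

theorem mem_op_T {σ : GroupSection (G × H)} {x : H × G} : x ∈ σ.op.T ↔ (x.2, x.1) ∈ σ.T :=
  Iff.rfl

theorem mem_op_S {σ : GroupSection (G × H)} {x : H × G} : x ∈ σ.op.S ↔ (x.2, x.1) ∈ σ.S :=
  Iff.rfl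

theorem op_op (σ : GroupSection (G × H)) : σ.op.op = σ := rfl

theorem leftInv_op (σ : GroupSection (G × H)) : leftInv σ.op = rightInv σ := by
  simp only [leftInv, rightInv, Prod.mk.injEq]
  refine ⟨?_, ?_, ?_, ?_⟩ <;> ext x <;> simp [mem_p₁, mem_p₂, mem_k₁, mem_k₂, mem_op_T, mem_op_S]

theorem rightInv_op (σ : GroupSection (G × H)) : rightInv σ.op = leftInv σ :=
  (leftInv_op σ.op).symm

theorem p₂_normal (σ : GroupSection (G × H)) (h : p₂ σ.T = ⊤) : (p₂ σ.S).Normal := by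
  constructor
  intro n hn g
  obtain ⟨a, ha⟩ := mem_p₂.1 hn
  obtain ⟨b, hb⟩ := mem_p₂.1 (h ▸ Subgroup.mem_top g : g ∈ p₂ σ.T)
  exact mem_p₂.2 ⟨b * a * b⁻¹, σ.conj_mem hb ha⟩

theorem p₁_normal (σ : GroupSection (G × H)) (h : p₁ σ.T = ⊤) : (p₁ σ.S).Normal := by
  constructor
  intro n hn g
  obtain ⟨a, ha⟩ := mem_p₁.1 hn
  obtain ⟨b, hb⟩ := mem_p₁.1 (h ▸ Subgroup.mem_top g : g ∈ p₁ σ.T)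
  exact mem_p₁.2 ⟨b * a * b⁻¹, σ.conj_mem hb ha⟩

theorem smul_tmk_eq_iff (S : Subgroup (G × H)) (U : Subgroup (H × K)) (a b : G × K)
    (v w : H × K) :
    a • tmk G H K ((1 : G × H) : (G × H) ⧸ S) (v : (H × K) ⧸ U) =
        b • tmk G H K ((1 : G × H) : (G × H) ⧸ S) (w : (H × K) ⧸ U) ↔
      ∃ h : H, (b.1⁻¹ * a.1, h) ∈ S ∧ w⁻¹ * (h, b.2⁻¹ * a.2) * v ∈ U := by
  rw [smul_tmk, smul_tmk, tmk_eq]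
  have e1 : ∀ h : H, ((1, h) : G × H) • ((a.1, 1) : G × H) • ((1 : G × H) : (G × H) ⧸ S) =
      ((b.1, 1) : G × H) • ((1 : G × H) : (G × H) ⧸ S) ↔ (b.1⁻¹ * a.1, h) ∈ S := by
    intro h
    rw [eq_comm, smul_smul, MulAction.Quotient.smul_mk, MulAction.Quotient.smul_mk]
    rw [QuotientGroup.eq]
    simp
  have e2 : ∀ h : H, ((h, 1) : H × K) • ((1, a.2) : H × K) • (v : (H × K) ⧸ U) =
      ((1, b.2) : H × K) • (w : (H × K) ⧸ U) ↔ w⁻¹ * (h, b.2⁻¹ * a.2) * v ∈ U := by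
    intro h
    rw [eq_comm, smul_smul, MulAction.Quotient.smul_mk, MulAction.Quotient.smul_mk]
    rw [QuotientGroup.eq]
    simp [mul_assoc, Prod.mul_def]
  simp only [e1, e2]

/-- The composition formula for two sections whose inner projections are surjective. -/
theorem compHom_section [Finite G] [Finite H] [Finite K] (σ : GroupSection (G × H))
    (τ : GroupSection (H × K)) (hσ : p₂ σ.T = ⊤) (hτ : p₁ τ.T = ⊤) :
    compHom G H K (mk σ.toGSetHom) (mk τ.toGSetHom) =
      (p₂ σ.S ⊔ p₁ τ.S).index • mk (σ.star τ).toGSetHom := by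
  rw [compHom_mk]
  have hP := p₂_normal σ hσ
  have hQ := p₁_normal τ hτ
  set N : Subgroup H := p₂ σ.S ⊔ p₁ τ.S with hN
  have hv : ∀ i : H ⧸ N, ∃ v : H × K, v ∈ τ.T ∧ ((v.1 : H) : H ⧸ N) = i := by
    intro i
    obtain ⟨h, rfl⟩ := QuotientGroup.mk_surjective i
    obtain ⟨k, hk⟩ := mem_p₁.1 (hτ ▸ Subgroup.mem_top h : h ∈ p₁ τ.T)
    exact ⟨(h, k), hk, rfl⟩
  choose v hvT hvi using hv
  have hconj : ∀ w ∈ τ.T, ∀ x : H × K, w⁻¹ * x * w ∈ τ.S ↔ x ∈ τ.S := by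
    intro w hw x
    constructor
    · intro h
      simpa [mul_assoc] using τ.conj_mem hw h
    · intro h
      simpa using τ.conj_mem (τ.T.inv_mem hw) h
  have hfix : ∀ i : H ⧸ N, ∀ a b : G × K,
      a • tmk G H K ((1 : G × H) : (G × H) ⧸ σ.S) (v i : (H × K) ⧸ τ.S) =
        b • tmk G H K ((1 : G × H) : (G × H) ⧸ σ.S) (v i : (H × K) ⧸ τ.S) ↔
      b⁻¹ * a ∈ (σ.star τ).S := by
    intro i a b
    rw [smul_tmk_eq_iff]
    simp only [hconj _ (hvT i)]
    rfl
  have hfixY : ∀ a b : G × K,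
      a • tmk G H K ((1 : G × H) : (G × H) ⧸ σ.T) ((1 : H × K) : (H × K) ⧸ τ.T) =
        b • tmk G H K ((1 : G × H) : (G × H) ⧸ σ.T) ((1 : H × K) : (H × K) ⧸ τ.T) ↔
      b⁻¹ * a ∈ (σ.star τ).T := by
    intro a b
    rw [smul_tmk_eq_iff]
    simp only [inv_one, one_mul, mul_one]
    rfl
  let α : ∀ i : H ⧸ N, (σ.star τ).toGSetHom.X →[G × K] (σ.toGSetHom.comp τ.toGSetHom).X :=
    fun i => orbitMap (σ.star τ).S
      (tmk G H K ((1 : G × H) : (G × H) ⧸ σ.S) (v i : (H × K) ⧸ τ.S))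
      (fun b hb => by
        have := (hfix i b 1).2 (by simpa using hb)
        rw [one_smul] at this
        exact this)
  let β : (σ.star τ).toGSetHom.Y →[G × K] (σ.toGSetHom.comp τ.toGSetHom).Y :=
    orbitMap (σ.star τ).T
      (tmk G H K ((1 : G × H) : (G × H) ⧸ σ.T) ((1 : H × K) : (H × K) ⧸ τ.T))
      (fun b hb => by
        have := (hfixY b 1).2 (by simpa using hb)
        rw [one_smul] at this
        exact this)
  refine mk_eq_card_smul (ι := H ⧸ N) α β ⟨?_, ?_⟩ ?_ ?_
  · rintro ⟨i, x⟩ ⟨j, y⟩ h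
    obtain ⟨a, rfl⟩ := QuotientGroup.mk_surjective x
    obtain ⟨b, rfl⟩ := QuotientGroup.mk_surjective y
    have h' : a • tmk G H K ((1 : G × H) : (G × H) ⧸ σ.S) (v i : (H × K) ⧸ τ.S) =
        b • tmk G H K ((1 : G × H) : (G × H) ⧸ σ.S) (v j : (H × K) ⧸ τ.S) := h
    have hij : i = j := by
      obtain ⟨c, h1, h2⟩ := (smul_tmk_eq_iff _ _ _ _ _ _).1 h'
      have hc : c ∈ N := Subgroup.mem_sup_left (mem_p₂.2 ⟨_, h1⟩)
      have hc' : (v j).1⁻¹ * c * (v i).1 ∈ N := Subgroup.mem_sup_right (mem_p₁.2 ⟨_, h2⟩)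
      rw [← hvi i, ← hvi j, eq_comm]
      refine QuotientGroup.eq.2 ?_
      have hNn : N.Normal := inferInstance
      have h3 := hNn.conj_mem _ (N.inv_mem hc) ((v j).1⁻¹)
      have h4 := N.mul_mem h3 hc'
      simpa [mul_assoc] using h4
    subst hij
    refine Prod.ext rfl (QuotientGroup.eq.2 ?_)
    have := (σ.star τ).S.inv_mem ((hfix i a b).1 h')
    simpa using this
  · intro z
    obtain ⟨x, y, rfl⟩ := tmk_surj z
    obtain ⟨x, rfl⟩ := QuotientGroup.mk_surjective x
    obtain ⟨y, rfl⟩ := QuotientGroup.mk_surjective y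
    have hmem : (v ((x.2⁻¹ * y.1 : H) : H ⧸ N)).1⁻¹ * (x.2⁻¹ * y.1) ∈ N :=
      QuotientGroup.eq.1 (hvi _)
    set i : H ⧸ N := ((x.2⁻¹ * y.1 : H) : H ⧸ N) with hi
    have hNn : N.Normal := inferInstance
    have hmem2 := hNn.conj_mem _ hmem (v i).1
    rw [mul_inv_cancel_left] at hmem2
    have hmem3 : x.2⁻¹ * y.1 * (v i).1⁻¹ ∈ N := hmem2
    obtain ⟨p, hp, q, hq, hpq⟩ := Subgroup.mem_sup_of_normal_right.1 hmem3
    obtain ⟨g, hg⟩ := mem_p₂.1 hp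
    have hq' := hQ.conj_mem _ hq (v i).1⁻¹
    obtain ⟨k, hk⟩ := mem_p₁.1 hq'
    refine ⟨(i, (((x.1 * g, y.2 * k⁻¹ * (v i).2⁻¹) : G × K) : (G × K) ⧸ (σ.star τ).S)), ?_⟩
    change ((x.1 * g, y.2 * k⁻¹ * (v i).2⁻¹) : G × K) •
      tmk G H K ((1 : G × H) : (G × H) ⧸ σ.S) (v i : (H × K) ⧸ τ.S) = _
    rw [smul_tmk]
    refine tmk_eq.2 ⟨x.2 * p, ?_, ?_⟩
    · rw [smul_smul, MulAction.Quotient.smul_mk, eq_comm]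
      refine QuotientGroup.eq.2 ?_
      have e : x⁻¹ * (((1, x.2 * p) : G × H) * ((x.1 * g, 1) : G × H) * 1) = (g, p) := by
        ext <;> simp
      simpa only [smul_eq_mul, e] using hg
    · rw [smul_smul, MulAction.Quotient.smul_mk, eq_comm]
      refine QuotientGroup.eq.2 ?_
      have e : y⁻¹ * (((x.2 * p, 1) : H × K) * ((1, y.2 * k⁻¹ * (v i).2⁻¹) : H × K) * v i) =
          ((v i).1⁻¹ * q * (v i).1⁻¹⁻¹, k)⁻¹ := by
        have h1 : y.1⁻¹ * x.2 = (v i).1⁻¹ * (p * q)⁻¹ := by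
          rw [hpq]
          group
        ext
        · simp only [Prod.fst_mul, Prod.fst_inv, mul_one]
          rw [← mul_assoc, ← mul_assoc, h1]
          group
        · simp
      simpa only [smul_eq_mul, e] using τ.S.inv_mem hk
  · intro x y h
    obtain ⟨a, rfl⟩ := QuotientGroup.mk_surjective x
    obtain ⟨b, rfl⟩ := QuotientGroup.mk_surjective y
    refine QuotientGroup.eq.2 ?_
    have := (σ.star τ).T.inv_mem ((hfixY a b).1 h)
    simpa using this
  · intro i x
    obtain ⟨a, rfl⟩ := QuotientGroup.mk_surjective x
    have h : a • tmk G H K ((1 : G × H) : (G × H) ⧸ σ.T) ((1 : H × K) : (H × K) ⧸ τ.T) =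
        a • tmk G H K ((1 : G × H) : (G × H) ⧸ σ.T) (v i : (H × K) ⧸ τ.T) := by
      congr 2
      refine QuotientGroup.eq.2 ?_
      simpa using hvT i
    exact h

end Product
/-! ### The endomorphism algebra -/

section EndRing

variable (G : Type u) [Group G]

/-- The section `(Δ(G), Δ(G))` of `G × G`. -/
def diagSection : GroupSection (G × G) :=
  GroupSection.ofConj (MonoidHom.prod (MonoidHom.id G) (MonoidHom.id G)).range
    (MonoidHom.prod (MonoidHom.id G) (MonoidHom.id G)).range le_rfl
    (fun _ ht _ hs => Subgroup.mul_mem _ (Subgroup.mul_mem _ ht hs) (Subgroup.inv_mem _ ht))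

/-- `Ξ(G × G)`, regarded as the ring of endomorphisms of `G` under composition. -/
def SliceEnd : Type (u + 1) := SliceBurnside (G × G)

instance : AddCommGroup (SliceEnd G) := inferInstanceAs (AddCommGroup (SliceBurnside (G × G)))

variable {G}

theorem mem_diag {x : G × G} : x ∈ (diagSection G).S ↔ x.1 = x.2 := by
  constructor
  · rintro ⟨a, rfl⟩
    rfl
  · intro h
    exact ⟨x.1, Prod.ext rfl h⟩

theorem tmk_diag_left {X : Type u} [MulAction (G × G) X] (a : G × G) (x : X) :
    tmk G G G (a : (G × G) ⧸ (diagSection G).S) x =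
      tmk G G G ((1 : G × G) : (G × G) ⧸ (diagSection G).S) (((a.1 * a.2⁻¹, 1) : G × G) • x) := by
  refine tmk_eq.2 ⟨a.1 * a.2⁻¹, ?_, rfl⟩
  rw [MulAction.Quotient.smul_mk]
  refine QuotientGroup.eq.2 (mem_diag.2 ?_)
  simp

theorem tmk_diag_right {X : Type u} [MulAction (G × G) X] (a : G × G) (x : X) :
    tmk G G G x (a : (G × G) ⧸ (diagSection G).S) =
      tmk G G G (((1, a.2 * a.1⁻¹) : G × G) • x)
        ((1 : G × G) : (G × G) ⧸ (diagSection G).S) := by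
  refine tmk_eq.2 ⟨a.2 * a.1⁻¹, rfl, ?_⟩
  rw [MulAction.Quotient.smul_mk]
  refine QuotientGroup.eq.2 (mem_diag.2 ?_)
  simp

/-- The isomorphism `X → G ×_G X`. -/
def unitLeft (X : Type u) [MulAction (G × G) X] :
    X →[G × G] Amalg G G G ((G × G) ⧸ (diagSection G).S) X where
  toFun x := tmk G G G ((1 : G × G) : (G × G) ⧸ (diagSection G).S) x
  map_smul' a x := by
    rw [id, smul_tmk, MulAction.Quotient.smul_mk, smul_eq_mul, mul_one, tmk_diag_left (a.1, 1),
      smul_smul]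
    simp

/-- The isomorphism `X → X ×_G G`. -/
def unitRight (X : Type u) [MulAction (G × G) X] :
    X →[G × G] Amalg G G G X ((G × G) ⧸ (diagSection G).S) where
  toFun x := tmk G G G x ((1 : G × G) : (G × G) ⧸ (diagSection G).S)
  map_smul' a x := by
    rw [id, smul_tmk, MulAction.Quotient.smul_mk, smul_eq_mul, mul_one, tmk_diag_right (1, a.2),
      smul_smul]
    simp

theorem unitLeft_bijective (X : Type u) [MulAction (G × G) X] :
    Function.Bijective (unitLeft (G := G) X) := by
  constructor
  · intro x y h
    obtain ⟨c, h1, h2⟩ := tmk_eq.1 h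
    rw [MulAction.Quotient.smul_mk] at h1
    have h3 := mem_diag.1 (QuotientGroup.eq.1 h1)
    have h4 : c = 1 := by simpa using h3.symm
    rw [← h2, h4, ← Prod.one_eq_mk, one_smul]
  · intro z
    obtain ⟨q, x, rfl⟩ := tmk_surj z
    obtain ⟨a, rfl⟩ := QuotientGroup.mk_surjective q
    exact ⟨_, (tmk_diag_left a x).symm⟩

theorem unitRight_bijective (X : Type u) [MulAction (G × G) X] :
    Function.Bijective (unitRight (G := G) X) := by
  constructor
  · intro x y h
    obtain ⟨c, h2, h1⟩ := tmk_eq.1 h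
    rw [MulAction.Quotient.smul_mk] at h1
    have h3 := mem_diag.1 (QuotientGroup.eq.1 h1)
    have h4 : c = 1 := by simpa using h3
    rw [← h2, h4, ← Prod.one_eq_mk, one_smul]
  · intro z
    obtain ⟨x, q, rfl⟩ := tmk_surj z
    obtain ⟨a, rfl⟩ := QuotientGroup.mk_surjective q
    exact ⟨_, (tmk_diag_right a x).symm⟩

theorem compHom_mem {H K L : Type u} [Group H] [Group K] [Group L]
    {a : SliceBurnside (H × K)} {b : SliceBurnside (K × L)}
    (ha : a ∈ sectionBurnside (H × K)) (hb : b ∈ sectionBurnside (K × L)) :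
    compHom H K L a b ∈ sectionBurnside (H × L) := by
  induction ha using AddSubgroup.closure_induction with
  | zero => rw [map_zero, AddMonoidHom.zero_apply]; exact zero_mem _
  | add x y _ _ hx hy => rw [map_add, AddMonoidHom.add_apply]; exact add_mem hx hy
  | neg x _ hx => rw [map_neg, AddMonoidHom.neg_apply]; exact neg_mem hx
  | mem x hx =>
  obtain ⟨M, hM, rfl⟩ := hx
  induction hb using AddSubgroup.closure_induction with
  | zero => rw [map_zero]; exact zero_mem _
  | add x y _ _ hx hy => rw [map_add]; exact add_mem hx hy
  | neg x _ hx => rw [map_neg]; exact neg_mem hx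
  | mem x hx =>
  obtain ⟨N, hN, rfl⟩ := hx
  rw [compHom_mk]
  exact AddSubgroup.subset_closure ⟨_, hM.comp hN, rfl⟩

variable [Finite G]

theorem compHom_one_left (a : SliceBurnside (G × G)) :
    compHom G G G (mk (diagSection G).toGSetHom) a = a := by
  induction a using induction_on with
  | hadd x y hx hy => rw [map_add, hx, hy]
  | hneg x hx => rw [map_neg, hx]
  | hzero => rw [map_zero]
  | hmk M =>
  rw [compHom_mk]
  symm
  exact mk_eq_of_inj (M := M) (N := (diagSection G).toGSetHom.comp M)
    (unitLeft M.X) (unitLeft M.Y) (unitLeft_bijective _) (unitLeft_bijective _).1 (fun _ => rfl)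

theorem compHom_one_right (a : SliceBurnside (G × G)) :
    compHom G G G a (mk (diagSection G).toGSetHom) = a := by
  induction a using induction_on with
  | hadd x y hx hy => rw [map_add, AddMonoidHom.add_apply, hx, hy]
  | hneg x hx => rw [map_neg, AddMonoidHom.neg_apply, hx]
  | hzero => rw [map_zero, AddMonoidHom.zero_apply]
  | hmk M =>
  rw [compHom_mk]
  symm
  exact mk_eq_of_inj (M := M) (N := M.comp (diagSection G).toGSetHom)
    (unitRight M.X) (unitRight M.Y) (unitRight_bijective _) (unitRight_bijective _).1
    (fun _ => rfl)

instance : Ring (SliceEnd G) :=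
  { (inferInstance : AddCommGroup (SliceEnd G)) with
    mul := fun a b => compHom G G G a b
    one := mk (diagSection G).toGSetHom
    mul_assoc := compHom_assoc
    one_mul := compHom_one_left
    mul_one := compHom_one_right
    left_distrib := fun a b c => map_add (compHom G G G a) b c
    right_distrib := fun a b c => congrArg (fun F => F c) (map_add (compHom G G G) a b)
    zero_mul := fun a => congrArg (fun F => F a) (map_zero (compHom G G G))
    mul_zero := fun a => map_zero (compHom G G G a) }

theorem sliceEnd_mul (a b : SliceEnd G) : a * b = compHom G G G a b := rfl

variable (G) in
/-- `Γ(G × G)` as a ring of endomorphisms of `G` under composition. -/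
def sectionEnd : Subring (SliceEnd G) :=
  { sectionBurnside (G × G) with
    one_mem' := AddSubgroup.subset_closure ⟨_, (diagSection G).isGalois, rfl⟩
    mul_mem' := fun ha hb => compHom_mem ha hb }

/-- The class of a section of `G × G` in `Γ(G × G)`. -/
def sectionClass (σ : GroupSection (G × G)) : sectionEnd G :=
  ⟨mk σ.toGSetHom, AddSubgroup.subset_closure ⟨_, σ.isGalois, rfl⟩⟩

theorem sectionClass_mul (σ τ : GroupSection (G × G)) (hσ : p₂ σ.T = ⊤) (hτ : p₁ τ.T = ⊤) :
    sectionClass σ * sectionClass τ = (p₂ σ.S ⊔ p₁ τ.S).index • sectionClass (σ.star τ) :=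
  Subtype.ext (compHom_section σ τ hσ hτ)

theorem sectionClass_diag : sectionClass (diagSection G) = 1 := rfl

end EndRing

section EndAlgebra

variable (k : Type v) [Field k] (G : Type u) [Group G] [Finite G]

/-- The endomorphism algebra `E_G = k ⊗ Γ(G × G)`. -/
def EndAlg : Type (max v (u + 1)) := k ⊗[ℤ] sectionEnd G

instance : Ring (EndAlg k G) := inferInstanceAs (Ring (k ⊗[ℤ] sectionEnd G))

instance : Algebra k (EndAlg k G) := inferInstanceAs (Algebra k (k ⊗[ℤ] sectionEnd G))

variable {G}

/-- The basis element of `E_G` given by a section of `G × G`. -/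
def basis (σ : GroupSection (G × G)) : EndAlg k G :=
  (1 : k) ⊗ₜ[ℤ] sectionClass σ

theorem basis_diag : basis k (diagSection G) = 1 := rfl

theorem basis_mul (σ τ : GroupSection (G × G)) (hσ : p₂ σ.T = ⊤) (hτ : p₁ τ.T = ⊤) :
    basis k σ * basis k τ = ((p₂ σ.S ⊔ p₁ τ.S).index : k) • basis k (σ.star τ) := by
  have h1 : basis k σ * basis k τ =
      ((1 : k) * 1) ⊗ₜ[ℤ] (sectionClass σ * sectionClass τ) :=
    Algebra.TensorProduct.tmul_mul_tmul _ _ _ _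
  rw [h1, sectionClass_mul σ τ hσ hτ, mul_one, TensorProduct.tmul_smul, Nat.cast_smul_eq_nsmul]
  rfl

end EndAlgebra

/-! ### The covering algebra -/

section Covering

variable {G H K : Type u} [Group G] [Group H] [Group K]

theorem p₁_star {S : Subgroup (G × H)} {U : Subgroup (H × K)} (h : p₂ S ≤ p₁ U) :
    p₁ (star S U) = p₁ S := by
  ext g
  rw [mem_p₁, mem_p₁]
  constructor
  · rintro ⟨_, c, h1, _⟩
    exact ⟨c, h1⟩
  · rintro ⟨c, h1⟩
    obtain ⟨d, h2⟩ := mem_p₁.1 (h (mem_p₂.2 ⟨g, h1⟩))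
    exact ⟨d, c, h1, h2⟩

theorem p₂_star {S : Subgroup (G × H)} {U : Subgroup (H × K)} (h : p₁ U ≤ p₂ S) :
    p₂ (star S U) = p₂ U := by
  ext g
  rw [mem_p₂, mem_p₂]
  constructor
  · rintro ⟨_, c, _, h1⟩
    exact ⟨c, h1⟩
  · rintro ⟨c, h1⟩
    obtain ⟨d, h2⟩ := mem_p₂.1 (h (mem_p₁.2 ⟨g, h1⟩))
    exact ⟨d, c, h2, h1⟩

theorem k₁_star {S : Subgroup (G × H)} {U : Subgroup (H × K)} (h : k₁ U ≤ k₂ S) :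
    k₁ (star S U) = k₁ S := by
  ext g
  rw [mem_k₁, mem_k₁]
  constructor
  · rintro ⟨c, h1, h2⟩
    have h3 : ((1 : G), c) ∈ S := h h2
    simpa using S.mul_mem h1 (S.inv_mem h3)
  · intro h1
    exact ⟨1, h1, U.one_mem⟩

theorem k₂_star {S : Subgroup (G × H)} {U : Subgroup (H × K)} (h : k₂ S ≤ k₁ U) :
    k₂ (star S U) = k₂ U := by
  ext g
  rw [mem_k₂, mem_k₂]
  constructor
  · rintro ⟨c, h1, h2⟩
    have h3 : (c, (1 : K)) ∈ U := h h1
    simpa using U.mul_mem (U.inv_mem h3) h2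
  · intro h1
    exact ⟨1, S.one_mem, h1⟩

theorem IsCovering.star {σ : GroupSection (G × H)} {τ : GroupSection (H × K)}
    (hσ : IsCovering σ) (hτ : IsCovering τ) : IsCovering (σ.star τ) := by
  obtain ⟨a1, a2, a3, a4⟩ := hσ
  obtain ⟨b1, b2, b3, b4⟩ := hτ
  refine ⟨?_, ?_, ?_, ?_⟩
  · exact (p₁_star (by rw [a2, b1])).trans a1
  · exact (p₂_star (by rw [a2, b1])).trans b2
  · exact (k₁_star (by rw [a4, b3])).trans a3
  · exact (k₂_star (by rw [a4, b3])).trans b4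

theorem isCovering_diag : IsCovering (diagSection G) := by
  have h : ∀ x : G × G, x ∈ (diagSection G).T ↔ x.1 = x.2 := fun x => mem_diag
  refine ⟨?_, ?_, ?_, ?_⟩ <;> ext g
  · simp [mem_p₁, h]
  · simp [mem_p₂, h]
  · simp [mem_k₁, mem_diag]
  · simp [mem_k₂, mem_diag, eq_comm]

/-- The covering algebra `E_G^c`: the linear span in `E_G` of the classes of all covering
sections of `G × G`; it is a subalgebra. -/
def coveringAlgebra (k : Type v) [Field k] (G : Type u) [Group G] [Finite G] :
    Subalgebra k (EndAlg k G) :=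
  (Submodule.span k { a | ∃ σ : GroupSection (G × G), IsCovering σ ∧ a = basis k σ }).toSubalgebra
    (Submodule.subset_span ⟨diagSection G, isCovering_diag, rfl⟩)
    (by
      intro a b ha hb
      induction ha using Submodule.span_induction with
      | zero => rw [zero_mul]; exact zero_mem _
      | add x y _ _ hx hy => rw [add_mul]; exact add_mem hx hy
      | smul c x _ hx => rw [smul_mul_assoc]; exact Submodule.smul_mem _ c hx
      | mem x hx =>
      obtain ⟨σ, hσ, rfl⟩ := hx
      induction hb using Submodule.span_induction with
      | zero => rw [mul_zero]; exact zero_mem _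
      | add x y _ _ hx hy => rw [mul_add]; exact add_mem hx hy
      | smul c x _ hx => rw [mul_smul_comm]; exact Submodule.smul_mem _ c hx
      | mem x hx =>
      obtain ⟨τ, hτ, rfl⟩ := hx
      rw [basis_mul k σ τ hσ.2.1 hτ.1]
      exact Submodule.smul_mem _ _ (Submodule.subset_span ⟨_, hσ.star hτ, rfl⟩))

end Covering

/-! ### The poset of pairs, linkage, and the idempotents -/

/-- The set `𝒢_G` of pairs `(K, P)` of normal subgroups of `G` with `[K, P] = 1`. -/
@[ext] structure GPair (G : Type u) [Group G] where
  K : Subgroup G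
  P : Subgroup G
  normalK : K.Normal
  normalP : P.Normal
  comm : ⁅K, P⁆ = ⊥

section Pairs

variable {G H L : Type u} [Group G] [Group H] [Group L]

/-- `(K, P) ≼ (L, Q)` if `K ≤ L` and `Q ≤ P`. -/
instance : PartialOrder (GPair G) where
  le x y := x.K ≤ y.K ∧ y.P ≤ x.P
  le_refl _ := ⟨le_rfl, le_rfl⟩
  le_trans _ _ _ h h' := ⟨h.1.trans h'.1, h'.2.trans h.2⟩
  le_antisymm _ _ h h' := GPair.ext (le_antisymm h.1 h'.1) (le_antisymm h'.2 h.2)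

instance [Finite G] : Finite (GPair G) :=
  Finite.of_injective (fun x : GPair G => (x.K, x.P))
    (fun _ _ h => GPair.ext (congrArg Prod.fst h) (congrArg Prod.snd h))

instance [Finite G] : Fintype (GPair G) := Fintype.ofFinite _

instance [Finite G] : LocallyFiniteOrder (GPair G) := by
  classical exact Fintype.toLocallyFiniteOrder

/-- `(G, K, P, 1)` and `(H, L, Q, 1)` are linked if there is a section of `G × H` having them
as left and right invariants. -/
def Linked (x : GPair G) (y : GPair H) : Prop :=
  ∃ σ : GroupSection (G × H),
    leftInv σ = (⊤, x.K, x.P, ⊥) ∧ rightInv σ = (⊤, y.K, y.P, ⊥)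

/-- The section `(Δ_K(G), Δ(P))` of `G × G`, where `Δ_K(G) = {(g, h) | h⁻¹ g ∈ K}` and
`Δ(P) = {(p, p) | p ∈ P}`. -/
def eSection (x : GPair G) : GroupSection (G × G) :=
  GroupSection.ofConj
    { carrier := { a | a.2⁻¹ * a.1 ∈ x.K }
      one_mem' := by simp [x.K.one_mem]
      mul_mem' := by
        intro a b ha hb
        have h := x.K.mul_mem (x.normalK.conj_mem _ ha b.2⁻¹) hb
        simpa [mul_assoc] using h
      inv_mem' := by
        intro a ha
        have h := x.normalK.conj_mem _ (x.K.inv_mem ha) a.2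
        simpa [mul_assoc] using h }
    (x.P.map (MonoidHom.prod (MonoidHom.id G) (MonoidHom.id G)))
    (by
      rintro _ ⟨p, hp, rfl⟩
      change p⁻¹ * p ∈ x.K
      rw [inv_mul_cancel]
      exact x.K.one_mem)
    (by
      rintro t ht _ ⟨p, hp, rfl⟩
      refine ⟨t.2 * p * t.2⁻¹, x.normalP.conj_mem p hp t.2, ?_⟩
      have h1 : t.2⁻¹ * t.1 ∈ x.K := ht
      have h2 : (t.2⁻¹ * t.1) * p = p * (t.2⁻¹ * t.1) :=
        (Subgroup.commutator_eq_bot_iff_le_centralizer.1 x.comm h1 p hp).symm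
      ext
      · change t.2 * p * t.2⁻¹ = t.1 * p * t.1⁻¹
        have h3 : t.1 * p = t.2 * p * (t.2⁻¹ * t.1) := by
          rw [mul_assoc t.2, ← h2]
          group
        rw [h3]
        group
      · rfl)

theorem mem_eSection_T {x : GPair G} {a : G × G} : a ∈ (eSection x).T ↔ a.2⁻¹ * a.1 ∈ x.K :=
  Iff.rfl

theorem mem_eSection_S {x : GPair G} {a : G × G} :
    a ∈ (eSection x).S ↔ a.1 = a.2 ∧ a.1 ∈ x.P := by
  constructor
  · rintro ⟨p, hp, rfl⟩
    exact ⟨rfl, hp⟩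
  · rintro ⟨h, hp⟩
    exact ⟨a.1, hp, Prod.ext rfl h⟩

theorem leftInv_eSection (x : GPair G) : leftInv (eSection x) = (⊤, x.K, x.P, ⊥) := by
  rw [leftInv_eq_iff]
  refine ⟨?_, ?_, ?_, ?_⟩ <;> ext g
  · simp only [mem_p₁, mem_eSection_T, Subgroup.mem_top, iff_true]
    exact ⟨g, by simp [x.K.one_mem]⟩
  · simp [mem_k₁, mem_eSection_T]
  · simp [mem_p₁, mem_eSection_S]
  · simp +contextual [mem_k₁, mem_eSection_S, x.P.one_mem]

theorem rightInv_eSection (x : GPair G) : rightInv (eSection x) = (⊤, x.K, x.P, ⊥) := by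
  rw [rightInv_eq_iff]
  refine ⟨?_, ?_, ?_, ?_⟩ <;> ext g
  · simp only [mem_p₂, mem_eSection_T, Subgroup.mem_top, iff_true]
    exact ⟨g, by simp [x.K.one_mem]⟩
  · simp [mem_k₂, mem_eSection_T]
  · simp [mem_p₂, mem_eSection_S]
  · simp +contextual [mem_k₂, mem_eSection_S, x.P.one_mem, eq_comm]

theorem leftInv_star {σ : GroupSection (G × H)} {τ : GroupSection (H × L)}
    (h : rightInv σ = leftInv τ) : leftInv (σ.star τ) = leftInv σ := by
  simp only [rightInv, leftInv, Prod.mk.injEq] at h ⊢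
  obtain ⟨h1, h2, h3, h4⟩ := h
  exact ⟨p₁_star h1.le, k₁_star h2.ge, p₁_star h3.le, k₁_star h4.ge⟩

theorem rightInv_star {σ : GroupSection (G × H)} {τ : GroupSection (H × L)}
    (h : rightInv σ = leftInv τ) : rightInv (σ.star τ) = rightInv τ := by
  simp only [rightInv, leftInv, Prod.mk.injEq] at h ⊢
  obtain ⟨h1, h2, h3, h4⟩ := h
  exact ⟨p₂_star h1.ge, k₂_star h2.le, p₂_star h3.ge, k₂_star h4.le⟩

theorem Linked.refl (x : GPair G) : Linked x x :=
  ⟨eSection x, leftInv_eSection x, rightInv_eSection x⟩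

theorem Linked.symm {x : GPair G} {y : GPair H} (h : Linked x y) : Linked y x := by
  obtain ⟨σ, h1, h2⟩ := h
  exact ⟨σ.op, (leftInv_op σ).trans h2, (rightInv_op σ).trans h1⟩

theorem Linked.trans {x : GPair G} {y : GPair H} {z : GPair L} (h : Linked x y)
    (h' : Linked y z) : Linked x z := by
  obtain ⟨σ, h1, h2⟩ := h
  obtain ⟨τ, h3, h4⟩ := h'
  have h5 := h2.trans h3.symm
  exact ⟨σ.star τ, (leftInv_star h5).trans h1, (rightInv_star h5).trans h4⟩

variable (G) in
/-- `G`-linkage, as an equivalence relation on `𝒢_G`. -/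
def linkageSetoid : Setoid (GPair G) where
  r := Linked
  iseqv := ⟨Linked.refl, Linked.symm, Linked.trans⟩

variable (G) in
/-- The set `𝒢_G / ∼` of linkage classes. -/
def LinkageClass : Type u := Quotient (linkageSetoid G)

/-- The linkage class `{K, P}_G`. -/
def linkageClass (x : GPair G) : LinkageClass G := Quotient.mk (linkageSetoid G) x

/-- The pairs belonging to a given linkage class. -/
abbrev LinkageClass.Members (c : LinkageClass G) : Type u := { x : GPair G // linkageClass x = c }

instance [Finite G] : Finite (LinkageClass G) :=
  inferInstanceAs (Finite (Quotient (linkageSetoid G)))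

theorem eSection_star {x : GPair G} {σ : GroupSection (G × H)}
    (h : leftInv σ = (⊤, x.K, x.P, ⊥)) : (eSection x).star σ = σ := by
  obtain ⟨-, h2, h3, -⟩ := leftInv_eq_iff.1 h
  ext ⟨g, a⟩
  · change (g, a) ∈ star (eSection x).T σ.T ↔ _
    simp only [mem_star, mem_eSection_T]
    constructor
    · rintro ⟨b, h4, h5⟩
      rw [← h2, mem_k₁] at h4
      simpa using σ.T.mul_mem h5 h4
    · intro h4
      exact ⟨g, by simp [x.K.one_mem], h4⟩
  · change (g, a) ∈ star (eSection x).S σ.S ↔ _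
    simp only [mem_star, mem_eSection_S]
    constructor
    · rintro ⟨b, ⟨rfl, _⟩, h5⟩
      exact h5
    · intro h4
      exact ⟨g, ⟨rfl, h3 ▸ mem_p₁.2 ⟨a, h4⟩⟩, h4⟩

theorem star_op {x : GPair G} {σ : GroupSection (G × H)}
    (h : leftInv σ = (⊤, x.K, x.P, ⊥)) : σ.star σ.op = eSection x := by
  obtain ⟨h1, h2, h3, h4⟩ := leftInv_eq_iff.1 h
  ext ⟨g, a⟩
  · change (g, a) ∈ star σ.T σ.op.T ↔ _
    simp only [mem_star, mem_eSection_T, mem_op_T, ← h2, mem_k₁]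
    constructor
    · rintro ⟨b, h5, h6⟩
      simpa using σ.T.mul_mem (σ.T.inv_mem h6) h5
    · intro h5
      obtain ⟨b, h6⟩ := mem_p₁.1 (h1 ▸ Subgroup.mem_top a : a ∈ p₁ σ.T)
      exact ⟨b, by simpa using σ.T.mul_mem h6 h5, h6⟩
  · change (g, a) ∈ star σ.S σ.op.S ↔ _
    simp only [mem_star, mem_eSection_S, mem_op_S, ← h3, mem_p₁]
    constructor
    · rintro ⟨b, h5, h6⟩
      have h7 : a⁻¹ * g ∈ k₁ σ.S := by
        rw [mem_k₁]
        simpa using σ.S.mul_mem (σ.S.inv_mem h6) h5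
      rw [h4, Subgroup.mem_bot, inv_mul_eq_one] at h7
      exact ⟨h7.symm, b, h5⟩
    · rintro ⟨rfl, b, h5⟩
      exact ⟨b, h5, h5⟩

variable (k : Type v) [Field k] [Finite G]

/-- The idempotent `e_{(K,P)}`, namely `1/|G : P|` times the class of `(Δ_K(G), Δ(P))`. -/
def eIdem (x : GPair G) : EndAlg k G := ((x.P.index : k))⁻¹ • basis k (eSection x)

open Classical in
/-- The idempotent `f_{(K,P)} = ∑ μ((K,P),(L,Q)) e_{(L,Q)}`, the sum over `(K,P) ≼ (L,Q)`, with
`μ` the Möbius function of `𝒢_G`. -/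
def fIdem (x : GPair G) : EndAlg k G :=
  ∑ y : GPair G with x ≤ y, IncidenceAlgebra.mu ℤ x y • eIdem k y

/-- The set `Γ_{(G,K,P)}` of all `1/|G : P|` times the class of a section of `G × G` whose left
and right invariants are both equal to `(G, K, P, 1)`. -/
def gammaSet (x : GPair G) : Set (EndAlg k G) :=
  { a | ∃ σ : GroupSection (G × G), leftInv σ = (⊤, x.K, x.P, ⊥) ∧
      rightInv σ = (⊤, x.K, x.P, ⊥) ∧ a = ((x.P.index : k))⁻¹ • basis k σ }

/-- The group `Γ_{(G,K,P)}`; its multiplication is that of `E_G`. -/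
def Gamma (x : GPair G) : Type (max v (u + 1)) := gammaSet k x

variable {k} [CharZero k]

theorem scaled_mul {x : GPair G} {σ τ : GroupSection (G × G)}
    (hσ : rightInv σ = (⊤, x.K, x.P, ⊥)) (hτ : leftInv τ = (⊤, x.K, x.P, ⊥)) :
    (((x.P.index : k))⁻¹ • basis k σ) * (((x.P.index : k))⁻¹ • basis k τ) =
      ((x.P.index : k))⁻¹ • basis k (σ.star τ) := by
  obtain ⟨h1, -, h3, -⟩ := rightInv_eq_iff.1 hσ
  obtain ⟨h5, -, h7, -⟩ := leftInv_eq_iff.1 hτ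
  have h0 : (x.P.index : k) ≠ 0 := Nat.cast_ne_zero.2 Subgroup.index_ne_zero_of_finite
  rw [smul_mul_smul_comm, basis_mul k σ τ h1 h5, h3, h7, sup_idem, smul_smul]
  congr 1
  field_simp

/-- The group structure of `Γ_{(G,K,P)}`: the product is that of `E_G`, the identity is
`e_{(K,P)}`, and inverses are given by opposite sections. -/
instance (x : GPair G) : Group (Gamma k x) :=
  letI : Mul (Gamma k x) := ⟨fun a b => ⟨a.1 * b.1, by
    obtain ⟨_, σ, h1, h2, rfl⟩ := a
    obtain ⟨_, τ, h3, h4, rfl⟩ := b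
    have h5 := h2.trans h3.symm
    exact ⟨σ.star τ, (leftInv_star h5).trans h1, (rightInv_star h5).trans h4,
      scaled_mul h2 h3⟩⟩⟩
  letI : One (Gamma k x) :=
    ⟨⟨eIdem k x, eSection x, leftInv_eSection x, rightInv_eSection x, rfl⟩⟩
  letI : Inv (Gamma k x) := ⟨fun a => ⟨((x.P.index : k))⁻¹ • basis k a.2.choose.op,
    a.2.choose.op, (leftInv_op _).trans a.2.choose_spec.2.1,
    (rightInv_op _).trans a.2.choose_spec.1, rfl⟩⟩
  Group.ofLeftAxioms
    (fun a b c => Subtype.ext (mul_assoc a.1 b.1 c.1))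
    (fun a => Subtype.ext (by
      obtain ⟨_, σ, h1, h2, rfl⟩ := a
      change eIdem k x * (((x.P.index : k))⁻¹ • basis k σ) = ((x.P.index : k))⁻¹ • basis k σ
      rw [eIdem, scaled_mul (rightInv_eSection x) h1, eSection_star h1]))
    (fun a => Subtype.ext (by
      have h := a.2.choose_spec
      change (((x.P.index : k))⁻¹ • basis k a.2.choose.op) * a.1 = eIdem k x
      have h1 : leftInv a.2.choose.op = (⊤, x.K, x.P, ⊥) := (leftInv_op _).trans h.2.1
      have h2 : rightInv a.2.choose.op = (⊤, x.K, x.P, ⊥) := (rightInv_op _).trans h.1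
      have h3 : a.1 = ((x.P.index : k))⁻¹ • basis k a.2.choose := h.2.2
      refine (congrArg _ h3).trans ?_
      rw [scaled_mul h2 h.1, eIdem, ← star_op h1, op_op]))

theorem Gamma.coe_mul (x : GPair G) (a b : Gamma k x) : (a * b).1 = a.1 * b.1 := rfl

theorem Gamma.coe_one (x : GPair G) : (1 : Gamma k x).1 = eIdem k x := rfl

end Pairs

end SectionBurnside

end

/-!
The covering algebra is the algebra of a finite inverse monoid, and the isomorphism is the passage
to its groupoid basis.

Divide the class of a covering section `σ = (T, S)` by `|G : p₁(S)|` to obtain `[σ]`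
(`scaledBasis`). As
`|G : Q| |G : P| = |G : QP| |G : Q ∩ P|` for normal subgroups, the composition formula becomes
`[σ][τ] = [σ * τ]` (`scaledBasis_mul`). Covering sections form an inverse monoid under `*`, with
`σ ↦ σ.op` as inversion, whose idempotents are the sections `(Δ_K(G), Δ(P))`; these multiply as
`e_x e_y = e_{x ⊔ y}` in the semilattice `𝒢_G`, so that the `f_x` are orthogonal idempotents with
sum `1` (`moebiusTransform_mul_moebiusTransform`, `sum_fIdem`).

If `σ` has left invariant `x` and right invariant `y`, then `f_x [σ] f_w = 0` for `w ≠ y` and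
`f_z [σ] f_y = 0` for `z ≠ x`; hence `f_x [σ] = [σ] f_y` (`fIdem_mul_scaledBasis`). The sections
`s_i` linking the representative of a linkage class to its members `x_i` thus provide matrix units,
and `(M_c)_c ↦ ∑ f_{x_i} [s_i.op] M_c(i, j) [s_j] f_{x_j}` is a homomorphism from the product of
matrix algebras to `E_G` (`linkFrame`, `MatrixFrame.algHom`). Its image is the covering algebra,
since `[σ] = ∑_z f_z [e_z * σ]` over the `z` above the left invariant of `σ`
(`linkFrame_algHom_range`). It is injective as soon as the elements `f_x γ`, for `γ ∈ Γ_x`, are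
linearly independent (`cornerHom_injective`): counting the points of `X` with stabilizer `S` whose
image has stabilizer `T` is a linear form on `E_G` that vanishes on the class of a section not
conjugate to `(T, S)`, and `f_x γ` differs from `γ` by classes of sections whose left invariants are
larger than `x`.
-/

noncomputable section

namespace SectionBurnside

/-! ### Möbius idempotents of a semilattice of idempotents -/

section Moebius

open Finset

variable {R ι : Type*} [Ring R] [Fintype ι] [SemilatticeSup ι] [LocallyFiniteOrder ι]

open Classical in
/-- The Möbius transform `∑_{x ≤ y} μ(x, y) e_y` of a family `e` indexed by a finite poset. -/
def moebiusTransform (e : ι → R) (x : ι) : R :=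
  ∑ y : ι with x ≤ y, IncidenceAlgebra.mu ℤ x y • e y

open Classical in
theorem sum_moebiusTransform (e : ι → R) (x : ι) :
    ∑ y : ι with x ≤ y, moebiusTransform e y = e x := by
  have h : ∀ y ∈ ({y | x ≤ y} : Finset ι), moebiusTransform e y =
      ∑ z : ι with x ≤ z, if y ≤ z then IncidenceAlgebra.mu ℤ y z • e z else 0 := by
    intro y hy
    rw [moebiusTransform, ← sum_filter, filter_filter]
    refine sum_congr (filter_congr fun z _ => ?_) fun _ _ => rfl
    exact ⟨fun h => ⟨(mem_filter.1 hy).2.trans h, h⟩, fun h => h.2⟩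
  rw [sum_congr rfl h, sum_comm]
  have h' : ∀ z ∈ ({z | x ≤ z} : Finset ι),
      (∑ y : ι with x ≤ y, if y ≤ z then IncidenceAlgebra.mu ℤ y z • e z else 0) =
        if x = z then e z else 0 := by
    intro z _
    rw [← sum_filter, filter_filter, ← sum_smul]
    have : ({y | x ≤ y ∧ y ≤ z} : Finset ι) = Icc x z := by
      ext y
      simp
    rw [this, IncidenceAlgebra.sum_Icc_mu_left]
    split_ifs <;> simp
  rw [sum_congr rfl h', sum_ite_eq]
  simp

variable {e : ι → R} (he : ∀ x y, e x * e y = e (x ⊔ y))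
include he

open Classical in
/-- By downward induction on `x`: both terms of `e_z f_x = e_{x ⊔ z} - ∑_{y > x} e_z f_y` are sums
of elements `f_y`, over `y ≥ x ⊔ z` and over `y > x` with `y ≥ z`. These index sets differ by the
element `x` if `z ≤ x`, and agree otherwise. -/
theorem mul_moebiusTransform (z x : ι) :
    e z * moebiusTransform e x = if z ≤ x then moebiusTransform e x else 0 := by
  induction x using WellFoundedGT.induction with | ind x ih =>
  have hx : moebiusTransform e x = e x - ∑ y : ι with x < y, moebiusTransform e y := by
    rw [eq_sub_iff_add_eq, ← sum_moebiusTransform e x]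
    have : ({y | x ≤ y} : Finset ι) = insert x ({y | x < y} : Finset ι) := by
      ext y
      simp [le_iff_eq_or_lt, eq_comm]
    rw [this, sum_insert (by simp)]
  have h1 : e z * moebiusTransform e x = ∑ y : ι with x ⊔ z ≤ y, moebiusTransform e y -
      ∑ y : ι with x < y ∧ z ≤ y, moebiusTransform e y := by
    have h2 : ∑ y : ι with x < y ∧ z ≤ y, moebiusTransform e y =
        ∑ y : ι with x < y, e z * moebiusTransform e y := by
      rw [← filter_filter, sum_filter]
      exact sum_congr rfl fun y hy => (ih y (mem_filter.1 hy).2).symm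
    rw [sum_moebiusTransform, hx, mul_sub, he, sup_comm, mul_sum, h2]
  split_ifs with h
  · rw [h1, hx, sup_eq_left.2 h, sum_moebiusTransform]
    congr 2
    ext y
    simp only [mem_filter, mem_univ, true_and, and_iff_left_iff_imp]
    exact fun hy => h.trans hy.le
  · rw [h1, sub_eq_zero]
    congr 1
    ext y
    simp only [mem_filter, mem_univ, true_and, sup_le_iff]
    refine ⟨fun hy => ⟨lt_of_le_of_ne hy.1 ?_, hy.2⟩, fun hy => ⟨hy.1.le, hy.2⟩⟩
    rintro rfl
    exact h hy.2

theorem commute_moebiusTransform (z x : ι) : Commute (e z) (moebiusTransform e x) := by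
  refine Commute.sum_right _ _ _ fun y _ => Commute.smul_right ?_ _
  rw [Commute, SemiconjBy, he, he, sup_comm]

open Classical in
theorem moebiusTransform_mul_moebiusTransform (x y : ι) :
    moebiusTransform e x * moebiusTransform e y = if x = y then moebiusTransform e y else 0 := by
  conv_lhs => enter [1]; rw [moebiusTransform]
  rw [sum_mul]
  simp only [smul_mul_assoc, mul_moebiusTransform he, smul_ite, smul_zero]
  rw [← sum_filter, filter_filter, ← sum_smul]
  have : ({z | x ≤ z ∧ z ≤ y} : Finset ι) = Icc x y := by
    ext z
    simp
  rw [this, IncidenceAlgebra.sum_Icc_mu_right]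
  split_ifs <;> simp

end Moebius

/-! ### Algebra maps out of a product of matrix algebras -/

section MatrixUnits

variable {k R C : Type*} [CommRing k] [Ring R] [Algebra k R] [Fintype C]
  {I : C → Type*} [∀ c, Fintype (I c)] [∀ c, DecidableEq (I c)]
  {A : C → Type*} [∀ c, Ring (A c)] [∀ c, Algebra k (A c)]

variable (k R A) in
/-- Data realising `∏_c Mat_{I_c}(A_c)` (up to a kernel) inside an algebra `R`: non-unital
images of the `A_c`, and elements `u_{c,i}`, `v_{c,j}` so that `a ↦ u_{c,i} a v_{c,j}` is the
inclusion of the `(i, j)` entry of the `c`-th factor. -/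
structure MatrixFrame (I : C → Type*) [∀ c, Fintype (I c)] [∀ c, DecidableEq (I c)] where
  ρ : ∀ c, A c →ₙₐ[k] R
  u : ∀ c, I c → R
  v : ∀ c, I c → R
  v_mul_u : ∀ c i j, v c i * u c j = if i = j then ρ c 1 else 0
  v_mul_u_of_ne : ∀ c d i j, c ≠ d → v c i * u d j = 0
  sum_eq_one : ∑ c, ∑ i, u c i * ρ c 1 * v c i = 1

namespace MatrixFrame

variable (F : MatrixFrame k R A I)

/-- The map `(M_c)_c ↦ ∑ u_{c,i} M_c(i,j) v_{c,j}`. -/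
def linearMap : (∀ c, Matrix (I c) (I c) (A c)) →ₗ[k] R where
  toFun M := ∑ c, ∑ i, ∑ j, F.u c i * F.ρ c (M c i j) * F.v c j
  map_add' M N := by
    simp only [Pi.add_apply, Matrix.add_apply, map_add, mul_add, add_mul, Finset.sum_add_distrib]
  map_smul' a M := by
    simp only [Pi.smul_apply, Matrix.smul_apply, map_smul, mul_smul_comm, smul_mul_assoc,
      Finset.smul_sum, RingHom.id_apply]

theorem linearMap_apply (M : ∀ c, Matrix (I c) (I c) (A c)) :
    F.linearMap M = ∑ c, ∑ i, ∑ j, F.u c i * F.ρ c (M c i j) * F.v c j := rfl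

theorem v_mul_linearMap (M : ∀ c, Matrix (I c) (I c) (A c)) (c : C) (i : I c) :
    F.v c i * F.linearMap M = ∑ j, F.ρ c (M c i j) * F.v c j := by
  rw [linearMap_apply, Finset.mul_sum, Finset.sum_eq_single c]
  · rw [Finset.mul_sum, Finset.sum_eq_single i]
    · simp only [Finset.mul_sum, ← mul_assoc, F.v_mul_u, if_true, ← map_mul, one_mul]
    · intro j _ hj
      simp only [Finset.mul_sum, ← mul_assoc, F.v_mul_u, if_neg hj.symm, zero_mul,
        Finset.sum_const_zero]
    · simp
  · intro d _ hd
    simp only [Finset.mul_sum, ← mul_assoc, F.v_mul_u_of_ne c d _ _ hd.symm, zero_mul,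
      Finset.sum_const_zero]
  · simp

theorem v_mul_linearMap_mul_u (M : ∀ c, Matrix (I c) (I c) (A c)) (c : C) (i j : I c) :
    F.v c i * F.linearMap M * F.u c j = F.ρ c (M c i j) := by
  rw [v_mul_linearMap, Finset.sum_mul, Finset.sum_eq_single j]
  · rw [mul_assoc, F.v_mul_u, if_pos rfl, ← map_mul, mul_one]
  · intro l _ hl
    rw [mul_assoc, F.v_mul_u, if_neg hl, mul_zero]
  · simp

theorem linearMap_mul (M N : ∀ c, Matrix (I c) (I c) (A c)) :
    F.linearMap (M * N) = F.linearMap M * F.linearMap N := by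
  rw [linearMap_apply F M]
  simp only [Finset.sum_mul, mul_assoc, v_mul_linearMap]
  rw [linearMap_apply]
  refine Finset.sum_congr rfl fun c _ => Finset.sum_congr rfl fun i _ => ?_
  simp only [Pi.mul_apply, Matrix.mul_apply, map_sum, map_mul, Finset.mul_sum, Finset.sum_mul,
    mul_assoc]
  exact Finset.sum_comm

theorem linearMap_one : F.linearMap 1 = 1 := by
  rw [linearMap_apply, ← F.sum_eq_one]
  refine Finset.sum_congr rfl fun c _ => Finset.sum_congr rfl fun i _ => ?_
  rw [Finset.sum_eq_single i]
  · simp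
  · intro j _ hj
    simp [Matrix.one_apply_ne hj.symm]
  · simp

/-- The map `(M_c)_c ↦ ∑ u_{c,i} M_c(i,j) v_{c,j}` as a homomorphism of algebras. -/
def algHom : (∀ c, Matrix (I c) (I c) (A c)) →ₐ[k] R :=
  AlgHom.ofLinearMap F.linearMap F.linearMap_one F.linearMap_mul

theorem algHom_injective (h : ∀ c, Function.Injective (F.ρ c)) :
    Function.Injective F.algHom := by
  intro M N hMN
  have hMN' : F.linearMap M = F.linearMap N := hMN
  funext c
  ext i j
  apply h c
  rw [← v_mul_linearMap_mul_u, hMN', v_mul_linearMap_mul_u]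

theorem algHom_single [DecidableEq C] (c : C) (i j : I c) (a : A c) :
    F.algHom (Pi.single c (Matrix.single i j a)) = F.u c i * F.ρ c a * F.v c j := by
  change F.linearMap _ = _
  rw [linearMap_apply, Finset.sum_eq_single c, Finset.sum_eq_single i, Finset.sum_eq_single j]
  · simp
  · intro l _ hl
    simp [Matrix.single, hl.symm]
  · simp
  · intro l _ hl
    simp [Matrix.single, hl.symm]
  · simp
  · intro d _ hd
    simp [Pi.single_eq_of_ne hd]
  · simp

theorem algHom_mem (S : Subalgebra k R) (hρ : ∀ c a, F.ρ c a ∈ S) (hu : ∀ c i, F.u c i ∈ S)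
    (hv : ∀ c i, F.v c i ∈ S) (M : ∀ c, Matrix (I c) (I c) (A c)) : F.algHom M ∈ S := by
  change F.linearMap M ∈ S
  rw [linearMap_apply]
  exact sum_mem fun c _ => sum_mem fun i _ => sum_mem fun j _ =>
    mul_mem (mul_mem (hu c i) (hρ c _)) (hv c j)

end MatrixFrame

end MatrixUnits

/-! ### The semilattice of commuting pairs of normal subgroups -/

section Semilattice

variable {G : Type u} [Group G]

/-- Joins in `𝒢_G` are given by `(K, P) ⊔ (L, Q) = (KL, P ∩ Q)`. -/
instance : SemilatticeSup (GPair G) where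
  sup x y :=
    { K := x.K ⊔ y.K
      P := x.P ⊓ y.P
      normalK := have := x.normalK; have := y.normalK; inferInstance
      normalP := have := x.normalP; have := y.normalP; inferInstance
      comm := by
        rw [Subgroup.commutator_eq_bot_iff_le_centralizer]
        have hx := Subgroup.commutator_eq_bot_iff_le_centralizer.1 x.comm
        have hy := Subgroup.commutator_eq_bot_iff_le_centralizer.1 y.comm
        exact sup_le (hx.trans (Subgroup.centralizer_le inf_le_left))
          (hy.trans (Subgroup.centralizer_le inf_le_right)) }
  le_sup_left _ _ := ⟨le_sup_left, inf_le_left⟩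
  le_sup_right _ _ := ⟨le_sup_right, inf_le_right⟩
  sup_le _ _ _ h h' := ⟨sup_le h.1 h'.1, le_inf h.2 h'.2⟩

theorem GPair.sup_K (x y : GPair G) : (x ⊔ y).K = x.K ⊔ y.K := rfl

theorem GPair.sup_P (x y : GPair G) : (x ⊔ y).P = x.P ⊓ y.P := rfl

instance : OrderBot (GPair G) where
  bot :=
    { K := ⊥
      P := ⊤
      normalK := inferInstance
      normalP := inferInstance
      comm := Subgroup.commutator_bot_left _ }
  bot_le _ := ⟨bot_le, le_top⟩

theorem eSection_bot : eSection (⊥ : GPair G) = diagSection G := by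
  ext ⟨g, a⟩
  · have h : (g, a) ∈ (diagSection G).T ↔ g = a := mem_diag
    rw [h, mem_eSection_T]
    change a⁻¹ * g ∈ (⊥ : Subgroup G) ↔ _
    rw [Subgroup.mem_bot, inv_mul_eq_one, eq_comm]
  · rw [mem_diag, mem_eSection_S]
    exact and_iff_left (Subgroup.mem_top g)

theorem eSection_star_eSection (x y : GPair G) :
    (eSection x).star (eSection y) = eSection (x ⊔ y) := by
  have := x.normalK
  ext ⟨g, a⟩
  · change (g, a) ∈ star (eSection x).T (eSection y).T ↔ _
    simp only [mem_star, mem_eSection_T, GPair.sup_K]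
    constructor
    · rintro ⟨h, h1, h2⟩
      have h3 := Subgroup.mul_mem_sup h2 h1
      rw [sup_comm]
      simpa [mul_assoc] using h3
    · intro h
      rw [sup_comm] at h
      obtain ⟨b, hb, c, hc, h1⟩ := Subgroup.mem_sup_of_normal_right.1 h
      refine ⟨a * b, ?_, by simpa using hb⟩
      have h2 : (a * b)⁻¹ * g = c := by
        rw [mul_inv_rev, mul_assoc, ← h1, inv_mul_cancel_left]
      exact h2 ▸ hc
  · change (g, a) ∈ star (eSection x).S (eSection y).S ↔ _
    simp only [mem_star, mem_eSection_S, GPair.sup_P, Subgroup.mem_inf]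
    constructor
    · rintro ⟨h, ⟨rfl, h1⟩, rfl, h2⟩
      exact ⟨rfl, h1, h2⟩
    · rintro ⟨rfl, h1, h2⟩
      exact ⟨g, ⟨rfl, h1⟩, rfl, h2⟩

end Semilattice

/-! ### The inverse monoid of covering sections -/

section Sections

variable {G H K L : Type u} [Group G] [Group H] [Group K] [Group L]

theorem star_assoc (σ : GroupSection (G × H)) (τ : GroupSection (H × K))
    (ω : GroupSection (K × L)) : (σ.star τ).star ω = σ.star (τ.star ω) := by
  have key : ∀ (S : Subgroup (G × H)) (U : Subgroup (H × K)) (V : Subgroup (K × L)),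
      star (star S U) V = star S (star U V) := by
    intro S U V
    ext ⟨g, a⟩
    constructor
    · rintro ⟨b, ⟨c, h1, h2⟩, h3⟩
      exact ⟨c, h1, b, h2, h3⟩
    · rintro ⟨c, h1, b, h2, h3⟩
      exact ⟨b, ⟨c, h1, h2⟩, h3⟩
  exact GroupSection.ext (key _ _ _) (key _ _ _)

theorem op_star (σ : GroupSection (G × H)) (τ : GroupSection (H × K)) :
    (σ.star τ).op = τ.op.star σ.op := by
  ext ⟨g, a⟩
  · exact exists_congr fun _ => and_comm
  · exact exists_congr fun _ => and_comm

theorem op_eSection (x : GPair G) : (eSection x).op = eSection x := by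
  ext ⟨g, a⟩
  · rw [mem_op_T, mem_eSection_T, mem_eSection_T, ← inv_mem_iff]
    simp
  · rw [mem_op_S, mem_eSection_S, mem_eSection_S]
    change a = g ∧ a ∈ x.P ↔ g = a ∧ g ∈ x.P
    constructor
    · rintro ⟨rfl, h⟩
      exact ⟨rfl, h⟩
    · rintro ⟨rfl, h⟩
      exact ⟨rfl, h⟩

theorem star_eSection {y : GPair H} {σ : GroupSection (G × H)}
    (h : rightInv σ = (⊤, y.K, y.P, ⊥)) : σ.star (eSection y) = σ := by
  have h1 := congrArg GroupSection.op (eSection_star ((leftInv_op σ).trans h))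
  rwa [op_star, op_op, op_eSection] at h1

theorem op_star_self {y : GPair H} {σ : GroupSection (G × H)}
    (h : rightInv σ = (⊤, y.K, y.P, ⊥)) : σ.op.star σ = eSection y :=
  star_op ((leftInv_op σ).trans h)

theorem IsCovering.of_inv {x : GPair G} {y : GPair H} {σ : GroupSection (G × H)}
    (h : leftInv σ = (⊤, x.K, x.P, ⊥)) (h' : rightInv σ = (⊤, y.K, y.P, ⊥)) : IsCovering σ :=
  ⟨(leftInv_eq_iff.1 h).1, (rightInv_eq_iff.1 h').1, (leftInv_eq_iff.1 h).2.2.2,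
    (rightInv_eq_iff.1 h').2.2.2⟩

theorem IsCovering.op {σ : GroupSection (G × H)} (h : IsCovering σ) : IsCovering σ.op := by
  have h1 := leftInv_op σ
  have h2 := rightInv_op σ
  simp only [leftInv, rightInv, Prod.mk.injEq] at h1 h2
  obtain ⟨a1, a2, a3, a4⟩ := h
  exact ⟨h1.1.trans a2, h2.1.trans a1, h1.2.2.2.trans a4, h2.2.2.2.trans a3⟩

theorem isCovering_eSection (x : GPair G) : IsCovering (eSection x) :=
  .of_inv (leftInv_eSection x) (rightInv_eSection x)

/-- The left invariant of a covering section `(T, S)` is given by a pair in `𝒢_G`: as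
`k₁(T) × 1` normalizes `S`, and `k₁(S) = 1`, the subgroups `k₁(T)` and `p₁(S)` commute. -/
theorem IsCovering.exists_leftInv {σ : GroupSection (G × H)} (h : IsCovering σ) :
    ∃ x : GPair G, leftInv σ = (⊤, x.K, x.P, ⊥) := by
  obtain ⟨h1, -, h3, -⟩ := h
  refine ⟨⟨k₁ σ.T, p₁ σ.S, ⟨fun n hn g => ?_⟩, p₁_normal σ h1, ?_⟩,
    leftInv_eq_iff.2 ⟨h1, rfl, rfl, h3⟩⟩
  · obtain ⟨a, ha⟩ := mem_p₁.1 (h1 ▸ Subgroup.mem_top g : g ∈ p₁ σ.T)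
    have := σ.T.mul_mem (σ.T.mul_mem ha hn) (σ.T.inv_mem ha)
    rw [mem_k₁]
    simpa using this
  · rw [Subgroup.commutator_eq_bot_iff_le_centralizer]
    intro c hc p hp
    obtain ⟨q, hq⟩ := mem_p₁.1 hp
    have h5 : (c * p * c⁻¹ * p⁻¹, (1 : H)) ∈ σ.S := by
      simpa using σ.S.mul_mem (σ.conj_mem hc hq) (σ.S.inv_mem hq)
    have h6 : c * p * c⁻¹ * p⁻¹ ∈ k₁ σ.S := h5
    rw [h3, Subgroup.mem_bot, mul_inv_eq_one, mul_inv_eq_iff_eq_mul] at h6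
    exact h6.symm

theorem IsCovering.exists_rightInv {σ : GroupSection (G × H)} (h : IsCovering σ) :
    ∃ y : GPair H, rightInv σ = (⊤, y.K, y.P, ⊥) := by
  obtain ⟨y, hy⟩ := h.op.exists_leftInv
  exact ⟨y, (leftInv_op σ).symm.trans hy⟩

theorem GPair.eq_of_leftInv {x z : GPair G} {σ : GroupSection (G × H)}
    (h : leftInv σ = (⊤, x.K, x.P, ⊥)) (h' : leftInv σ = (⊤, z.K, z.P, ⊥)) : x = z := by
  rw [h, Prod.mk.injEq, Prod.mk.injEq, Prod.mk.injEq] at h'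
  exact GPair.ext h'.2.1 h'.2.2.1

theorem GPair.eq_of_rightInv {x z : GPair H} {σ : GroupSection (G × H)}
    (h : rightInv σ = (⊤, x.K, x.P, ⊥)) (h' : rightInv σ = (⊤, z.K, z.P, ⊥)) : x = z := by
  rw [h, Prod.mk.injEq, Prod.mk.injEq, Prod.mk.injEq] at h'
  exact GPair.ext h'.2.1 h'.2.2.1

theorem le_of_leftInv_star {x z : GPair G} {σ : GroupSection (G × H)} {τ : GroupSection (H × K)}
    (h : leftInv σ = (⊤, x.K, x.P, ⊥)) (h' : leftInv (σ.star τ) = (⊤, z.K, z.P, ⊥)) :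
    x ≤ z := by
  obtain ⟨-, h1, h2, -⟩ := leftInv_eq_iff.1 h
  obtain ⟨-, h3, h4, -⟩ := leftInv_eq_iff.1 h'
  constructor
  · rw [← h1, ← h3]
    exact fun g hg => ⟨1, hg, τ.T.one_mem⟩
  · rw [← h2, ← h4]
    intro g hg
    obtain ⟨_, b, h5, _⟩ := mem_p₁.1 hg
    exact mem_p₁.2 ⟨b, h5⟩

theorem leftInv_eSection_star {x y : GPair G} (hxy : x ≤ y) {σ : GroupSection (G × H)}
    (h : leftInv σ = (⊤, x.K, x.P, ⊥)) :
    leftInv ((eSection y).star σ) = (⊤, y.K, y.P, ⊥) := by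
  obtain ⟨h1, h2, h3, h4⟩ := leftInv_eq_iff.1 h
  obtain ⟨a1, a2, a3, a4⟩ := leftInv_eq_iff.1 (leftInv_eSection y)
  obtain ⟨b1, b2, b3, b4⟩ := rightInv_eq_iff.1 (rightInv_eSection y)
  refine leftInv_eq_iff.2 ⟨?_, ?_, ?_, ?_⟩
  · exact (p₁_star (by rw [h1, b1])).trans a1
  · exact (k₁_star (by rw [h2, b2]; exact hxy.1)).trans a2
  · exact (p₁_star (by rw [h3, b3]; exact hxy.2)).trans a3
  · exact (k₁_star (by rw [h4, b4])).trans a4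

end Sections

/-! ### The scaled basis of the covering algebra -/

section Card

variable {G H K : Type u} [Group G] [Group H] [Group K]

theorem card_p₁ {W : Subgroup (G × H)} (h : k₂ W = ⊥) : Nat.card (p₁ W) = Nat.card W := by
  symm
  refine Nat.card_eq_of_bijective ((MonoidHom.fst G H).subgroupMap W)
    ⟨(injective_iff_map_eq_one _).2 ?_, (MonoidHom.fst G H).subgroupMap_surjective W⟩
  rintro ⟨⟨g, a⟩, hga⟩ h1
  have h2 : g = 1 := congrArg Subtype.val h1
  subst h2
  have h3 : a ∈ k₂ W := hga
  rw [h, Subgroup.mem_bot] at h3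
  subst h3
  rfl

theorem card_p₂ {W : Subgroup (G × H)} (h : k₁ W = ⊥) : Nat.card (p₂ W) = Nat.card W := by
  symm
  refine Nat.card_eq_of_bijective ((MonoidHom.snd G H).subgroupMap W)
    ⟨(injective_iff_map_eq_one _).2 ?_, (MonoidHom.snd G H).subgroupMap_surjective W⟩
  rintro ⟨⟨g, a⟩, hga⟩ h1
  have h2 : a = 1 := congrArg Subtype.val h1
  subst h2
  have h3 : g ∈ k₁ W := hga
  rw [h, Subgroup.mem_bot] at h3
  subst h3
  rfl

theorem index_eq_of_card_eq [Finite G] {P Q : Subgroup G} (h : Nat.card P = Nat.card Q) :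
    P.index = Q.index := by
  have h1 := P.card_mul_index
  rw [← Q.card_mul_index, h] at h1
  exact Nat.eq_of_mul_eq_mul_left Nat.card_pos h1

theorem index_mul_index_eq (P Q : Subgroup G) [P.Normal] :
    P.index * Q.index = (P ⊔ Q).index * (P ⊓ Q).index := by
  rw [← Subgroup.relIndex_mul_index (le_sup_left : P ≤ P ⊔ Q), Subgroup.relIndex_sup_left,
    ← Subgroup.relIndex_mul_index (inf_le_right : P ⊓ Q ≤ Q), Subgroup.inf_relIndex_right]
  ring

/-- When `k₁(S)` and `k₂(S)` are trivial, `S` is the graph of an isomorphism `p₁(S) ≅ p₂(S)`, which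
carries the domain of the composed relation to `p₂(S) ∩ p₁(U)`. -/
theorem card_p₁_star {S : Subgroup (G × H)} {U : Subgroup (H × K)} (h1 : k₁ S = ⊥)
    (h2 : k₂ S = ⊥) : Nat.card (p₁ (star S U)) = Nat.card (p₂ S ⊓ p₁ U : Subgroup H) := by
  let W : Subgroup (G × H) := S ⊓ (p₁ U).comap (MonoidHom.snd G H)
  have hW1 : k₁ W = ⊥ := eq_bot_iff.2 fun g hg => h1.le (mem_k₁.2 hg.1)
  have hW2 : k₂ W = ⊥ := eq_bot_iff.2 fun g hg => h2.le (mem_k₂.2 hg.1)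
  have e1 : p₁ (star S U) = p₁ W := by
    ext g
    rw [mem_p₁, mem_p₁]
    constructor
    · rintro ⟨a, b, hb, hb'⟩
      exact ⟨b, hb, mem_p₁.2 ⟨a, hb'⟩⟩
    · rintro ⟨b, hb, hb'⟩
      obtain ⟨a, ha⟩ := mem_p₁.1 hb'
      exact ⟨a, b, hb, ha⟩
  have e2 : p₂ S ⊓ p₁ U = p₂ W := by
    ext b
    rw [Subgroup.mem_inf, mem_p₂, mem_p₂]
    constructor
    · rintro ⟨⟨g, hg⟩, hb⟩
      exact ⟨g, hg, hb⟩
    · rintro ⟨g, hg, hb⟩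
      exact ⟨⟨g, hg⟩, hb⟩
  rw [e1, e2, card_p₁ hW2, card_p₂ hW1]

end Card

section Scaled

variable (k : Type v) [Field k] {G : Type u} [Group G] [Finite G]

/-- The class of a section `(T, S)` of `G × G`, divided by the index of `p₁(S)` in `G`. -/
def scaledBasis (σ : GroupSection (G × G)) : EndAlg k G :=
  ((p₁ σ.S).index : k)⁻¹ • basis k σ

theorem eIdem_eq (x : GPair G) : eIdem k x = scaledBasis k (eSection x) := by
  rw [scaledBasis, (leftInv_eq_iff.1 (leftInv_eSection x)).2.2.1, eIdem]

theorem scaledBasis_mem {σ : GroupSection (G × G)} (h : IsCovering σ) :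
    scaledBasis k σ ∈ coveringAlgebra k G :=
  Submodule.smul_mem _ _ (Submodule.subset_span ⟨σ, h, rfl⟩)

/-- With this scaling the basis of `E_G^c` is multiplicative: the index `|G : Q P'|` in the
composition formula is cancelled by `|G : Q| |G : P'| = |G : Q P'| |G : Q ∩ P'|`. -/
theorem scaledBasis_mul [CharZero k] {σ τ : GroupSection (G × G)} (hσ : IsCovering σ)
    (hτ : IsCovering τ) :
    scaledBasis k σ * scaledBasis k τ = scaledBasis k (σ.star τ) := by
  obtain ⟨-, h2, h3, h4⟩ := hσ
  obtain ⟨h5, -, -, -⟩ := hτ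
  have hn := p₂_normal σ h2
  have e1 : (p₁ σ.S).index = (p₂ σ.S).index :=
    index_eq_of_card_eq ((card_p₁ h4).trans (card_p₂ h3).symm)
  have e2 : (p₁ (σ.star τ).S).index = (p₂ σ.S ⊓ p₁ τ.S).index :=
    index_eq_of_card_eq (card_p₁_star h3 h4)
  have e3 : ((p₂ σ.S).index : k) * (p₁ τ.S).index =
      (p₂ σ.S ⊔ p₁ τ.S).index * (p₂ σ.S ⊓ p₁ τ.S).index := by
    exact_mod_cast index_mul_index_eq (p₂ σ.S) (p₁ τ.S)
  have h0 : ∀ P : Subgroup G, (P.index : k) ≠ 0 := fun P =>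
    Nat.cast_ne_zero.2 Subgroup.index_ne_zero_of_finite
  rw [scaledBasis, scaledBasis, smul_mul_smul_comm, basis_mul k σ τ h2 h5, smul_smul,
    scaledBasis, e1, e2, ← mul_inv, e3]
  congr 1
  have := h0 (p₂ σ.S ⊔ p₁ τ.S)
  have := h0 (p₂ σ.S ⊓ p₁ τ.S)
  field_simp

end Scaled

/-! ### The orthogonal idempotents `f_{(K,P)}` -/

section Idempotents

variable {k : Type v} [Field k] {G : Type u} [Group G] [Finite G]

theorem fIdem_eq (x : GPair G) : fIdem k x = moebiusTransform (eIdem k) x := rfl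

theorem eIdem_mem (x : GPair G) : eIdem k x ∈ coveringAlgebra k G := by
  rw [eIdem_eq]
  exact scaledBasis_mem k (isCovering_eSection x)

theorem fIdem_mem (x : GPair G) : fIdem k x ∈ coveringAlgebra k G :=
  sum_mem fun y _ => zsmul_mem (eIdem_mem y) _

variable [CharZero k]

theorem eIdem_mul_eIdem (x y : GPair G) : eIdem k x * eIdem k y = eIdem k (x ⊔ y) := by
  rw [eIdem_eq, eIdem_eq, scaledBasis_mul k (isCovering_eSection x) (isCovering_eSection y),
    eSection_star_eSection, eIdem_eq]

theorem eIdem_mul_fIdem_of_le {x z : GPair G} (h : z ≤ x) :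
    eIdem k z * fIdem k x = fIdem k x := by
  rw [fIdem_eq, mul_moebiusTransform eIdem_mul_eIdem, if_pos h]

theorem eIdem_mul_fIdem_of_not_le {x z : GPair G} (h : ¬z ≤ x) :
    eIdem k z * fIdem k x = 0 := by
  rw [fIdem_eq, mul_moebiusTransform eIdem_mul_eIdem, if_neg h]

theorem commute_eIdem_fIdem (x z : GPair G) : Commute (eIdem k z) (fIdem k x) :=
  commute_moebiusTransform eIdem_mul_eIdem z x

theorem fIdem_mul_fIdem_of_ne {x y : GPair G} (h : x ≠ y) : fIdem k x * fIdem k y = 0 := by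
  rw [fIdem_eq, fIdem_eq, moebiusTransform_mul_moebiusTransform eIdem_mul_eIdem, if_neg h]

theorem fIdem_mul_self (x : GPair G) : fIdem k x * fIdem k x = fIdem k x := by
  rw [fIdem_eq, moebiusTransform_mul_moebiusTransform eIdem_mul_eIdem, if_pos rfl]

omit [CharZero k] in
theorem eIdem_bot : eIdem k (⊥ : GPair G) = 1 := by
  have h : (⊥ : GPair G).P.index = 1 := Subgroup.index_top
  rw [eIdem, h, eSection_bot, basis_diag, Nat.cast_one, inv_one, one_smul]

omit [CharZero k] in
theorem sum_fIdem : ∑ x : GPair G, fIdem k x = 1 := by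
  classical
  rw [← eIdem_bot, ← sum_moebiusTransform (eIdem k) (⊥ : GPair G)]
  refine Finset.sum_congr ?_ fun _ _ => rfl
  ext x
  simp

/-- For `w > y` the section `σ * e_w` has a left invariant which is strictly larger than that of
`σ`, and is therefore annihilated by `f_x`. -/
theorem fIdem_mul_scaledBasis_mul_fIdem_of_ne_right {x y w : GPair G} {σ : GroupSection (G × G)}
    (hl : leftInv σ = (⊤, x.K, x.P, ⊥)) (hr : rightInv σ = (⊤, y.K, y.P, ⊥)) (hw : w ≠ y) :
    fIdem k x * scaledBasis k σ * fIdem k w = 0 := by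
  have hσ := IsCovering.of_inv hl hr
  have hy : scaledBasis k σ * eIdem k y = scaledBasis k σ := by
    rw [eIdem_eq, scaledBasis_mul k hσ (isCovering_eSection y), star_eSection hr]
  by_cases hyw : y ≤ w
  · have hcov := hσ.star (isCovering_eSection w)
    obtain ⟨z, hz⟩ := hcov.exists_leftInv
    -- If `σ * e_w` still had left invariant `x`, then `e_w = σ.op * (σ * e_w)` would have left
    -- invariant `y`.
    have hzx : ¬z ≤ x := by
      intro h
      obtain rfl : x = z := le_antisymm (le_of_leftInv_star hl hz) h
      have h1 : rightInv σ.op = leftInv (σ.star (eSection w)) :=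
        ((rightInv_op σ).trans hl).trans hz.symm
      have h2 := (leftInv_star h1).trans ((leftInv_op σ).trans hr)
      rw [← star_assoc, op_star_self hr, eSection_star_eSection, sup_eq_right.2 hyw] at h2
      exact hw (GPair.eq_of_leftInv (leftInv_eSection w) h2)
    rw [← eIdem_mul_fIdem_of_le (le_refl w), mul_assoc, ← mul_assoc (scaledBasis k σ),
      eIdem_eq (k := k) w, scaledBasis_mul k hσ (isCovering_eSection w), ← eSection_star hz,
      ← scaledBasis_mul k (isCovering_eSection z) hcov, ← eIdem_eq, ← mul_assoc, ← mul_assoc,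
      ← (commute_eIdem_fIdem x z).eq, eIdem_mul_fIdem_of_not_le hzx, zero_mul, zero_mul]
  · rw [← hy, mul_assoc, mul_assoc, eIdem_mul_fIdem_of_not_le hyw, mul_zero, mul_zero]

theorem fIdem_mul_scaledBasis_of_not_le {x z : GPair G} {σ : GroupSection (G × G)}
    (hσ : IsCovering σ) (hl : leftInv σ = (⊤, x.K, x.P, ⊥)) (h : ¬x ≤ z) :
    fIdem k z * scaledBasis k σ = 0 := by
  rw [← eSection_star hl, ← scaledBasis_mul k (isCovering_eSection x) hσ, ← eIdem_eq, ← mul_assoc,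
    ← (commute_eIdem_fIdem z x).eq, eIdem_mul_fIdem_of_not_le h, zero_mul]

theorem fIdem_mul_scaledBasis_eq_star {z : GPair G} {σ : GroupSection (G × G)}
    (hσ : IsCovering σ) :
    fIdem k z * scaledBasis k σ = fIdem k z * scaledBasis k ((eSection z).star σ) := by
  rw [← scaledBasis_mul k (isCovering_eSection z) hσ, ← eIdem_eq, ← mul_assoc,
    ← (commute_eIdem_fIdem z z).eq, eIdem_mul_fIdem_of_le le_rfl]

/-- For `z > x` the section `e_z * σ` has a right invariant different from that of `σ`, so that
`fIdem_mul_scaledBasis_mul_fIdem_of_ne_right` applies to it. -/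
theorem fIdem_mul_scaledBasis_mul_fIdem_of_ne_left {x y z : GPair G} {σ : GroupSection (G × G)}
    (hl : leftInv σ = (⊤, x.K, x.P, ⊥)) (hr : rightInv σ = (⊤, y.K, y.P, ⊥)) (hz : z ≠ x) :
    fIdem k z * scaledBasis k σ * fIdem k y = 0 := by
  have hσ := IsCovering.of_inv hl hr
  by_cases hxz : x ≤ z
  · have hl' := leftInv_eSection_star hxz hl
    obtain ⟨w, hw⟩ := ((isCovering_eSection z).star hσ).exists_rightInv
    rw [fIdem_mul_scaledBasis_eq_star hσ]
    refine fIdem_mul_scaledBasis_mul_fIdem_of_ne_right hl' hw ?_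
    rintro rfl
    have h1 : rightInv ((eSection z).star σ) = leftInv σ.op :=
      hw.trans ((leftInv_op σ).trans hr).symm
    have h2 := (rightInv_star h1).trans ((rightInv_op σ).trans hl)
    rw [star_assoc, star_op hl, eSection_star_eSection, sup_eq_left.2 hxz] at h2
    exact hz (GPair.eq_of_rightInv (rightInv_eSection z) h2)
  · rw [fIdem_mul_scaledBasis_of_not_le hσ hl hxz, zero_mul]

/-- A section with left invariant `x` and right invariant `y` intertwines `f_x` and `f_y`: by
orthogonality both sides are equal to `f_x [σ] f_y`. -/
theorem fIdem_mul_scaledBasis {x y : GPair G} {σ : GroupSection (G × G)}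
    (hl : leftInv σ = (⊤, x.K, x.P, ⊥)) (hr : rightInv σ = (⊤, y.K, y.P, ⊥)) :
    fIdem k x * scaledBasis k σ = scaledBasis k σ * fIdem k y := by
  have h1 : fIdem k x * scaledBasis k σ = fIdem k x * scaledBasis k σ * fIdem k y := by
    conv_lhs => rw [← mul_one (fIdem k x * scaledBasis k σ), ← sum_fIdem]
    rw [Finset.mul_sum, Finset.sum_eq_single y]
    · exact fun w _ hw => fIdem_mul_scaledBasis_mul_fIdem_of_ne_right hl hr hw
    · simp
  have h2 : scaledBasis k σ * fIdem k y = fIdem k x * (scaledBasis k σ * fIdem k y) := by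
    conv_lhs => rw [← one_mul (scaledBasis k σ * fIdem k y), ← sum_fIdem]
    rw [Finset.sum_mul, Finset.sum_eq_single x]
    · intro z _ hz
      rw [← mul_assoc]
      exact fIdem_mul_scaledBasis_mul_fIdem_of_ne_left hl hr hz
    · simp
  rw [h1, h2, mul_assoc]

end Idempotents

/-! ### Separating the classes of sections -/

section Marks

variable (k : Type v) [Field k] {A : Type u} [Group A]

theorem stabilizer_map {X Y : Type*} [MulAction A X] [MulAction A Y] (α : X →[A] Y)
    (hα : Function.Injective α) (x : X) :
    MulAction.stabilizer A (α x) = MulAction.stabilizer A x := by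
  ext a
  rw [MulAction.mem_stabilizer_iff, MulAction.mem_stabilizer_iff, ← map_smul, hα.eq_iff]

/-- The points `x` of the source of a morphism `f` such that `x` has stabilizer `S` and `f(x)`
has stabilizer `T`. -/
def stabSet (σ : GroupSection A) (M : GSetHom A) : Set M.X :=
  { x | MulAction.stabilizer A x = σ.S ∧ MulAction.stabilizer A (M.toHom x) = σ.T }

theorem ncard_stabSet_restrict (σ : GroupSection A) (M : GSetHom A) (U : SubMulAction A M.X) :
    (stabSet σ (M.restrict U)).ncard = (stabSet σ M ∩ U).ncard := by
  refine (Set.ncard_image_of_injective (f := (Subtype.val : U → M.X)) (stabSet σ (M.restrict U))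
    Subtype.val_injective).symm.trans ?_
  congr 1
  have key : ∀ x : U, x ∈ stabSet σ (M.restrict U) ↔ x.1 ∈ stabSet σ M := by
    intro x
    have h1 := stabilizer_map (subIncl U) Subtype.val_injective x
    have h2 := stabilizer_map (subIncl (M.imageOf U)) Subtype.val_injective
      ((M.restrict U).toHom x)
    change _ ∧ _ ↔ MulAction.stabilizer A (subIncl U x) = σ.S ∧
      MulAction.stabilizer A (subIncl (M.imageOf U) ((M.restrict U).toHom x)) = σ.T
    rw [h1, h2]
    rfl
  ext x
  constructor
  · rintro ⟨y, hy, rfl⟩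
    exact ⟨(key y).1 hy, y.2⟩
  · rintro ⟨hx, hxU⟩
    exact ⟨⟨x, hxU⟩, (key ⟨x, hxU⟩).2 hx, rfl⟩

/-- The additive map on `Ξ(A)` that counts the points of the source of `f` with stabilizer `S`
whose image has stabilizer `T`. On classes of sections it detects conjugacy to `(T, S)`. -/
def stabCount (σ : GroupSection A) : SliceBurnside A →+ k :=
  lift (fun M => ((stabSet σ M).ncard : k))
    (by
      rintro M N ⟨α, β, hα, hβ, h⟩
      have h1 : stabSet σ N = α '' stabSet σ M := by
        ext y
        obtain ⟨x, rfl⟩ := hα.2 y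
        rw [hα.1.mem_set_image]
        change _ ∧ _ ↔ _ ∧ _
        rw [stabilizer_map α hα.1, ← h, stabilizer_map β hβ.1]
      rw [h1, Set.ncard_image_of_injective _ hα.1])
    (by
      intro M U V h
      rw [ncard_stabSet_restrict, ncard_stabSet_restrict, ← h.compl_eq, ← Set.sdiff_eq,
        ← Nat.cast_add, Set.ncard_inter_add_ncard_sdiff_eq_ncard _ _ (Set.toFinite _)])

theorem stabCount_mk (σ : GroupSection A) (M : GSetHom A) :
    stabCount k σ (mk M) = (stabSet σ M).ncard := lift_mk _ _ _ _

theorem stabilizer_coe (B : Subgroup A) (a t : A) :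
    t ∈ MulAction.stabilizer A (a : A ⧸ B) ↔ a⁻¹ * t * a ∈ B := by
  rw [MulAction.mem_stabilizer_iff, eq_comm, MulAction.Quotient.smul_mk, QuotientGroup.eq,
    smul_eq_mul, mul_assoc]

/-- `σ` is the conjugate of `τ` by `a`. -/
def GroupSection.ConjBy (a : A) (σ τ : GroupSection A) : Prop :=
  (∀ t, t ∈ σ.S ↔ a⁻¹ * t * a ∈ τ.S) ∧ ∀ t, t ∈ σ.T ↔ a⁻¹ * t * a ∈ τ.T

variable [Finite A]

theorem mem_stabSet_iff {σ τ : GroupSection A} {a : A} :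
    ((a : A ⧸ τ.S) : τ.toGSetHom.X) ∈ stabSet σ τ.toGSetHom ↔ GroupSection.ConjBy a σ τ := by
  change MulAction.stabilizer A (a : A ⧸ τ.S) = σ.S ∧
    MulAction.stabilizer A (a : A ⧸ τ.T) = σ.T ↔ _
  rw [SetLike.ext_iff, SetLike.ext_iff]
  simp only [stabilizer_coe, GroupSection.ConjBy, Iff.comm]

theorem exists_conjBy_of_stabCount_ne_zero {σ τ : GroupSection A}
    (h : stabCount k σ (mk τ.toGSetHom) ≠ 0) : ∃ a, GroupSection.ConjBy a σ τ := by
  rw [stabCount_mk] at h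
  obtain ⟨x, hx⟩ := Set.nonempty_of_ncard_ne_zero fun h0 => h (by rw [h0, Nat.cast_zero])
  obtain ⟨a, rfl⟩ := QuotientGroup.mk_surjective (s := τ.S) x
  exact ⟨a, mem_stabSet_iff.1 hx⟩

theorem stabCount_self_ne_zero [CharZero k] (σ : GroupSection A) :
    stabCount k σ (mk σ.toGSetHom) ≠ 0 := by
  rw [stabCount_mk, Nat.cast_ne_zero]
  refine (Set.ncard_pos (Set.toFinite _)).2 ⟨((1 : A) : A ⧸ σ.S), mem_stabSet_iff.2 ?_⟩ |>.ne'
  constructor <;> simp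

theorem mk_eq_of_conjBy {σ τ : GroupSection A} {a : A} (h : GroupSection.ConjBy a σ τ) :
    mk σ.toGSetHom = mk τ.toGSetHom := by
  have key : ∀ B C : Subgroup A, (∀ t, t ∈ B ↔ a⁻¹ * t * a ∈ C) → ∃ α : A ⧸ B →[A] A ⧸ C,
      Function.Bijective α ∧ ∀ c : A, α (c : A ⧸ B) = ((c * a : A) : A ⧸ C) := by
    intro B C h
    refine ⟨orbitMap B (a : A ⧸ C) fun b hb => (stabilizer_coe C a b).2 ((h b).1 hb), ⟨?_, ?_⟩,
      fun c => rfl⟩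
    · intro x y hxy
      obtain ⟨c, rfl⟩ := QuotientGroup.mk_surjective x
      obtain ⟨d, rfl⟩ := QuotientGroup.mk_surjective y
      have h1 : ((c * a : A) : A ⧸ C) = (d * a : A) := hxy
      rw [QuotientGroup.eq, h]
      simpa [mul_assoc] using QuotientGroup.eq.1 h1
    · intro y
      obtain ⟨d, rfl⟩ := QuotientGroup.mk_surjective y
      refine ⟨((d * a⁻¹ : A) : A ⧸ B), ?_⟩
      change ((d * a⁻¹ * a : A) : A ⧸ C) = d
      rw [inv_mul_cancel_right]
  obtain ⟨α, hα, h1⟩ := key _ _ h.1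
  obtain ⟨β, hβ, h2⟩ := key _ _ h.2
  refine mk_eq_of_iso ⟨α, β, hα, hβ, fun x => ?_⟩
  obtain ⟨c, rfl⟩ := QuotientGroup.mk_surjective (s := σ.S) x
  exact (h2 c).trans (congrArg τ.toGSetHom.toHom (h1 c)).symm

end Marks

section Functional

variable (k : Type v) [Field k] {G : Type u} [Group G]

theorem GroupSection.ConjBy.leftInv_eq {x : GPair G} {σ τ : GroupSection (G × G)} {a : G × G}
    (h : GroupSection.ConjBy a σ τ) (hτ : leftInv τ = (⊤, x.K, x.P, ⊥)) :
    leftInv σ = (⊤, x.K, x.P, ⊥) := by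
  have hconj : ∀ N : Subgroup G, N.Normal → ∀ g, a.1⁻¹ * g * a.1 ∈ N ↔ g ∈ N := by
    intro N hN g
    constructor
    · intro h
      simpa [mul_assoc] using hN.conj_mem _ h a.1
    · intro h
      simpa using hN.conj_mem _ h a.1⁻¹
  have hp : ∀ S U : Subgroup (G × G), (∀ t, t ∈ S ↔ a⁻¹ * t * a ∈ U) → (p₁ U).Normal →
      p₁ S = p₁ U := by
    intro S U h hn
    ext g
    rw [← hconj _ hn, mem_p₁, mem_p₁]
    constructor
    · rintro ⟨b, hb⟩
      exact ⟨_, (h _).1 hb⟩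
    · rintro ⟨b, hb⟩
      refine ⟨a.2 * b * a.2⁻¹, (h _).2 ?_⟩
      convert hb using 1
      ext <;> simp [mul_assoc]
  have hk : ∀ S U : Subgroup (G × G), (∀ t, t ∈ S ↔ a⁻¹ * t * a ∈ U) → (k₁ U).Normal →
      k₁ S = k₁ U := by
    intro S U h hn
    ext g
    rw [← hconj _ hn, mem_k₁, mem_k₁, h]
    have : a⁻¹ * (g, 1) * a = (a.1⁻¹ * g * a.1, 1) := by ext <;> simp
    rw [this]
  obtain ⟨h1, h2, h3, h4⟩ := leftInv_eq_iff.1 hτ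
  refine leftInv_eq_iff.2 ⟨?_, ?_, ?_, ?_⟩
  · rw [hp _ _ h.2 (by rw [h1]; infer_instance), h1]
  · rw [hk _ _ h.2 (h2 ▸ x.normalK), h2]
  · rw [hp _ _ h.1 (h3 ▸ x.normalP), h3]
  · rw [hk _ _ h.1 (by rw [h4]; infer_instance), h4]

variable [Finite G]

/-- The linear form on `E_G` given by `stabCount`. -/
def stabForm (σ : GroupSection (G × G)) : EndAlg k G →ₗ[k] k :=
  LinearMap.liftBaseChange k
    ((stabCount k σ).comp (sectionEnd G).subtype.toAddMonoidHom).toIntLinearMap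

theorem stabForm_basis (σ τ : GroupSection (G × G)) :
    stabForm k σ (basis k τ) = stabCount k σ (mk τ.toGSetHom) := by
  refine (LinearMap.liftBaseChange_tmul (R := ℤ) (A := k) (M := sectionEnd G) (N := k)
    _ _ _).trans ?_
  rw [one_smul]
  rfl

theorem stabForm_scaledBasis (σ τ : GroupSection (G × G)) :
    stabForm k σ (scaledBasis k τ) =
      ((p₁ τ.S).index : k)⁻¹ * stabCount k σ (mk τ.toGSetHom) := by
  rw [scaledBasis, map_smul, stabForm_basis, smul_eq_mul]

theorem stabForm_scaledBasis_self_ne_zero [CharZero k] (σ : GroupSection (G × G)) :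
    stabForm k σ (scaledBasis k σ) ≠ 0 := by
  rw [stabForm_scaledBasis]
  exact mul_ne_zero (inv_ne_zero (Nat.cast_ne_zero.2 Subgroup.index_ne_zero_of_finite))
    (stabCount_self_ne_zero k σ)

theorem exists_conjBy_of_stabForm_ne_zero {σ τ : GroupSection (G × G)}
    (h : stabForm k σ (scaledBasis k τ) ≠ 0) : ∃ a, GroupSection.ConjBy a σ τ := by
  rw [stabForm_scaledBasis] at h
  exact exists_conjBy_of_stabCount_ne_zero k (right_ne_zero_of_mul h)

theorem basis_eq_of_conjBy {σ τ : GroupSection (G × G)} {a : G × G}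
    (h : GroupSection.ConjBy a σ τ) : basis k σ = basis k τ := by
  have : sectionClass σ = sectionClass τ := Subtype.ext (mk_eq_of_conjBy h)
  rw [basis, this, basis]

/-- Multiplication by `f_x` changes the class of a section with left invariant `x` only by
classes of sections whose left invariants are strictly larger. -/
theorem stabForm_fIdem_mul [CharZero k] {x : GPair G} {σ τ : GroupSection (G × G)}
    (hτ : IsCovering τ) (hσl : leftInv σ = (⊤, x.K, x.P, ⊥))
    (hτl : leftInv τ = (⊤, x.K, x.P, ⊥)) :
    stabForm k σ (fIdem k x * scaledBasis k τ) = stabForm k σ (scaledBasis k τ) := by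
  classical
  rw [fIdem_eq, moebiusTransform, Finset.sum_mul, map_sum, Finset.sum_eq_single x]
  · rw [IncidenceAlgebra.mu_self, one_smul, eIdem_eq,
      scaledBasis_mul k (isCovering_eSection x) hτ, eSection_star hτl]
  · intro y hy hyx
    have hle : x ≤ y := (Finset.mem_filter.1 hy).2
    rw [smul_mul_assoc, map_zsmul, eIdem_eq, scaledBasis_mul k (isCovering_eSection y) hτ]
    suffices h : stabForm k σ (scaledBasis k ((eSection y).star τ)) = 0 by rw [h, smul_zero]
    by_contra h
    obtain ⟨a, ha⟩ := exists_conjBy_of_stabForm_ne_zero k h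
    exact hyx (GPair.eq_of_leftInv (ha.leftInv_eq (leftInv_eSection_star hle hτl)) hσl)
  · simp

end Functional

/-! ### The group algebras `kΓ_{(G,K,P)}` inside the covering algebra -/

section GroupAlgebra

variable {k : Type v} [Field k] {G : Type u} [Group G] [Finite G]

theorem scaledBasis_eq {x : GPair G} {σ : GroupSection (G × G)}
    (h : leftInv σ = (⊤, x.K, x.P, ⊥)) :
    scaledBasis k σ = ((x.P.index : k))⁻¹ • basis k σ := by
  rw [scaledBasis, (leftInv_eq_iff.1 h).2.2.1]

theorem Gamma.exists_section {x : GPair G} (γ : Gamma k x) :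
    ∃ σ : GroupSection (G × G), leftInv σ = (⊤, x.K, x.P, ⊥) ∧
      rightInv σ = (⊤, x.K, x.P, ⊥) ∧ γ.1 = scaledBasis k σ := by
  obtain ⟨_, σ, h1, h2, rfl⟩ := γ
  exact ⟨σ, h1, h2, (scaledBasis_eq h1).symm⟩

/-- The element of `Γ_{(G,K,P)}` given by a section. -/
def Gamma.ofSection (k : Type v) [Field k] {x : GPair G} (σ : GroupSection (G × G))
    (hl : leftInv σ = (⊤, x.K, x.P, ⊥)) (hr : rightInv σ = (⊤, x.K, x.P, ⊥)) : Gamma k x :=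
  ⟨scaledBasis k σ, σ, hl, hr, scaledBasis_eq hl⟩

variable [CharZero k]

theorem Gamma.fIdem_mul {x : GPair G} (γ : Gamma k x) : fIdem k x * γ.1 = γ.1 * fIdem k x := by
  obtain ⟨σ, h1, h2, h3⟩ := γ.exists_section
  rw [h3, fIdem_mul_scaledBasis h1 h2]

variable (k) in
/-- The embedding `γ ↦ f_{(K,P)} γ` of `Γ_{(G,K,P)}` into the covering algebra, extended linearly
to the group algebra. -/
def cornerHom (x : GPair G) : MonoidAlgebra k (Gamma k x) →ₙₐ[k] EndAlg k G :=
  MonoidAlgebra.liftMagma k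
    { toFun := fun γ => fIdem k x * γ.1
      map_mul' := fun γ δ => by
        rw [Gamma.coe_mul, mul_assoc, ← mul_assoc γ.1, ← γ.fIdem_mul, mul_assoc (fIdem k x) γ.1,
          ← mul_assoc (fIdem k x) (fIdem k x), fIdem_mul_self] }

theorem cornerHom_apply (x : GPair G) (a : MonoidAlgebra k (Gamma k x)) :
    cornerHom k x a = a.coeff.sum fun γ t => t • (fIdem k x * γ.1) := rfl

theorem cornerHom_single (x : GPair G) (γ : Gamma k x) :
    cornerHom k x (MonoidAlgebra.single γ 1) = fIdem k x * γ.1 := by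
  rw [cornerHom_apply]
  simp

theorem cornerHom_one (x : GPair G) : cornerHom k x 1 = fIdem k x := by
  rw [MonoidAlgebra.one_def, cornerHom_single, Gamma.coe_one, ← (commute_eIdem_fIdem x x).eq,
    eIdem_mul_fIdem_of_le le_rfl]

theorem cornerHom_mem (x : GPair G) (a : MonoidAlgebra k (Gamma k x)) :
    cornerHom k x a ∈ coveringAlgebra k G := by
  rw [cornerHom_apply]
  refine sum_mem fun γ _ => Subalgebra.smul_mem _ (mul_mem (fIdem_mem x) ?_) _
  obtain ⟨σ, h1, h2, h3⟩ := γ.exists_section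
  exact h3 ▸ scaledBasis_mem k (.of_inv h1 h2)

/-- The linear form `stabForm σ`, for a section `σ` representing `γ`, reads off the coefficient of
`γ` up to a non-zero factor. -/
theorem cornerHom_injective (x : GPair G) : Function.Injective (cornerHom k x) := by
  refine (injective_iff_map_eq_zero _).2 fun a ha => ?_
  ext γ
  obtain ⟨σ, h1, h2, h3⟩ := γ.exists_section
  have h4 := congrArg (stabForm k σ) ha
  rw [cornerHom_apply, Finsupp.sum, map_sum, map_zero, Finset.sum_eq_single γ] at h4
  · rw [map_smul, h3, stabForm_fIdem_mul k (.of_inv h1 h2) h1 h1, smul_eq_mul] at h4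
    exact (mul_eq_zero.1 h4).resolve_right (stabForm_scaledBasis_self_ne_zero k σ)
  · intro δ _ hδ
    obtain ⟨τ, t1, t2, t3⟩ := δ.exists_section
    rw [map_smul, t3, stabForm_fIdem_mul k (.of_inv t1 t2) h1 t1]
    suffices h : stabForm k σ (scaledBasis k τ) = 0 by rw [h, smul_zero]
    by_contra h
    obtain ⟨b, hb⟩ := exists_conjBy_of_stabForm_ne_zero k h
    refine hδ (Subtype.ext ?_)
    rw [t3, h3, scaledBasis_eq t1, scaledBasis_eq h1, basis_eq_of_conjBy k hb]
  · intro h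
    rw [Finsupp.notMem_support_iff.1 h, zero_smul, map_zero]

end GroupAlgebra

/-! ### The decomposition of the covering algebra -/

section Link

variable {G : Type u} [Group G]

variable (rep : LinkageClass G → GPair G) (hrep : ∀ c, linkageClass (rep c) = c)
  (enum : ∀ c : LinkageClass G, Fin (Nat.card c.Members) ≃ c.Members)

include hrep in
theorem exists_link (c : LinkageClass G) (i : Fin (Nat.card c.Members)) :
    ∃ σ : GroupSection (G × G), leftInv σ = (⊤, (rep c).K, (rep c).P, ⊥) ∧
      rightInv σ = (⊤, (enum c i).1.K, (enum c i).1.P, ⊥) :=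
  Quotient.exact ((hrep c).trans (enum c i).2.symm)

/-- A section of `G × G` linking the chosen representative of a linkage class to the `i`-th member
of the class. -/
def link (c : LinkageClass G) (i : Fin (Nat.card c.Members)) : GroupSection (G × G) :=
  (exists_link rep hrep enum c i).choose

theorem leftInv_link (c : LinkageClass G) (i : Fin (Nat.card c.Members)) :
    leftInv (link rep hrep enum c i) = (⊤, (rep c).K, (rep c).P, ⊥) :=
  (exists_link rep hrep enum c i).choose_spec.1

theorem rightInv_link (c : LinkageClass G) (i : Fin (Nat.card c.Members)) :
    rightInv (link rep hrep enum c i) = (⊤, (enum c i).1.K, (enum c i).1.P, ⊥) :=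
  (exists_link rep hrep enum c i).choose_spec.2

theorem isCovering_link (c : LinkageClass G) (i : Fin (Nat.card c.Members)) :
    IsCovering (link rep hrep enum c i) :=
  .of_inv (leftInv_link rep hrep enum c i) (rightInv_link rep hrep enum c i)

end Link

section Decomposition

variable {k : Type v} [Field k] [CharZero k] {G : Type u} [Group G] [Finite G]

instance : Fintype (LinkageClass G) := Fintype.ofFinite _

theorem scaledBasis_mul_fIdem_mul_scaledBasis_op {x y : GPair G} {σ : GroupSection (G × G)}
    (hl : leftInv σ = (⊤, x.K, x.P, ⊥)) (hr : rightInv σ = (⊤, y.K, y.P, ⊥)) :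
    scaledBasis k σ * fIdem k y * scaledBasis k σ.op = fIdem k x := by
  have hσ := IsCovering.of_inv hl hr
  rw [← fIdem_mul_scaledBasis hl hr, mul_assoc, scaledBasis_mul k hσ hσ.op, star_op hl,
    ← eIdem_eq, ← (commute_eIdem_fIdem x x).eq, eIdem_mul_fIdem_of_le le_rfl]

variable (rep : LinkageClass G → GPair G) (hrep : ∀ c, linkageClass (rep c) = c)
  (enum : ∀ c : LinkageClass G, Fin (Nat.card c.Members) ≃ c.Members)

theorem sum_enum {B : Type*} [AddCommMonoid B] (F : GPair G → B) :
    ∑ c, ∑ i, F (enum c i).1 = ∑ x, F x := by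
  classical
  let E : (Σ c : LinkageClass G, Fin (Nat.card c.Members)) ≃ GPair G :=
    (Equiv.sigmaCongrRight enum).trans (Equiv.sigmaFiberEquiv linkageClass)
  rw [← Fintype.sum_sigma', ← E.sum_comp]
  rfl

theorem fIdem_link (c : LinkageClass G) (i : Fin (Nat.card c.Members)) :
    fIdem k (enum c i).1 * scaledBasis k (link rep hrep enum c i).op * fIdem k (rep c) *
      (scaledBasis k (link rep hrep enum c i) * fIdem k (enum c i).1) =
        fIdem k (enum c i).1 := by
  have h := scaledBasis_mul_fIdem_mul_scaledBasis_op (k := k)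
    ((leftInv_op _).trans (rightInv_link rep hrep enum c i))
    ((rightInv_op _).trans (leftInv_link rep hrep enum c i))
  rw [op_op] at h
  rw [← mul_assoc, mul_assoc (fIdem k _), mul_assoc (fIdem k _), h, fIdem_mul_self,
    fIdem_mul_self]

variable (k) in
/-- The matrix units of the covering algebra: with `s_i` linking the representative to the `i`-th
member `x_i` of its class, `f_{x_i} s_i^{op}` and `s_j f_{x_j}` carry the corner at the
representative to the `(i, j)` entry. -/
def linkFrame : MatrixFrame k (EndAlg k G) (fun c => MonoidAlgebra k (Gamma k (rep c)))
    (fun c => Fin (Nat.card c.Members)) where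
  ρ c := cornerHom k (rep c)
  u c i := fIdem k (enum c i).1 * scaledBasis k (link rep hrep enum c i).op
  v c i := scaledBasis k (link rep hrep enum c i) * fIdem k (enum c i).1
  v_mul_u c i j := by
    rw [mul_assoc, ← mul_assoc (fIdem k _)]
    split_ifs with h
    · subst h
      rw [fIdem_mul_self, ← mul_assoc, scaledBasis_mul_fIdem_mul_scaledBasis_op
        (leftInv_link rep hrep enum c i) (rightInv_link rep hrep enum c i), cornerHom_one]
    · rw [fIdem_mul_fIdem_of_ne, zero_mul, mul_zero]
      exact fun h' => h ((enum c).injective (Subtype.ext h'))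
  v_mul_u_of_ne c d i j h := by
    rw [mul_assoc, ← mul_assoc (fIdem k _), fIdem_mul_fIdem_of_ne, zero_mul, mul_zero]
    exact fun h' => h ((enum c i).2.symm.trans ((congrArg linkageClass h').trans (enum d j).2))
  sum_eq_one := by
    rw [← sum_fIdem, ← sum_enum enum]
    refine Finset.sum_congr rfl fun c _ => Finset.sum_congr rfl fun i _ => ?_
    rw [cornerHom_one]
    exact fIdem_link rep hrep enum c i

open Classical in
theorem linkFrame_single_one (c : LinkageClass G) (i : Fin (Nat.card c.Members)) :
    (linkFrame k rep hrep enum).algHom (Pi.single c (Matrix.single i i 1)) =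
      fIdem k (enum c i).1 := by
  rw [MatrixFrame.algHom_single]
  change _ * cornerHom k (rep c) 1 * _ = _
  rw [cornerHom_one]
  exact fIdem_link rep hrep enum c i

theorem fIdem_mul_scaledBasis_mem_range {z w : GPair G} {τ : GroupSection (G × G)}
    (hl : leftInv τ = (⊤, z.K, z.P, ⊥)) (hr : rightInv τ = (⊤, w.K, w.P, ⊥)) :
    fIdem k z * scaledBasis k τ ∈ (linkFrame k rep hrep enum).algHom.range := by
  classical
  obtain ⟨c, hc⟩ : ∃ c, linkageClass z = c := ⟨_, rfl⟩
  have hw : linkageClass w = c := (Quotient.sound (s := linkageSetoid G) ⟨τ, hl, hr⟩).symm.trans hc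
  obtain ⟨i, hi⟩ := (enum c).surjective ⟨z, hc⟩
  obtain ⟨j, hj⟩ := (enum c).surjective ⟨w, hw⟩
  have hi1 := leftInv_link rep hrep enum c i
  have hi2 := rightInv_link rep hrep enum c i
  have hj1 := leftInv_link rep hrep enum c j
  have hj2 := rightInv_link rep hrep enum c j
  have hu : (linkFrame k rep hrep enum).u c i =
    fIdem k (enum c i).1 * scaledBasis k (link rep hrep enum c i).op := rfl
  have hv : (linkFrame k rep hrep enum).v c j =
    scaledBasis k (link rep hrep enum c j) * fIdem k (enum c j).1 := rfl
  have hρ : (linkFrame k rep hrep enum).ρ c = cornerHom k (rep c) := rfl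
  rw [hi] at hi2 hu
  rw [hj] at hj2 hv
  generalize link rep hrep enum c i = s at *
  generalize link rep hrep enum c j = t at *
  have hs := IsCovering.of_inv hi1 hi2
  have ht := IsCovering.of_inv hj1 hj2
  have hτ := IsCovering.of_inv hl hr
  have hsτ : rightInv s = leftInv τ := hi2.trans hl.symm
  have hτt : rightInv (s.star τ) = leftInv t.op :=
    (rightInv_star hsτ).trans (hr.trans ((leftInv_op t).trans hj2).symm)
  -- The `(i, j)` entry of the matrix is `τ` transported to the representative of its class.
  let γ : Gamma k (rep c) := Gamma.ofSection k ((s.star τ).star t.op)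
    ((leftInv_star hτt).trans ((leftInv_star hsτ).trans hi1))
    ((rightInv_star hτt).trans ((rightInv_op t).trans hj1))
  have hγ : γ.1 = scaledBasis k ((s.star τ).star t.op) := rfl
  have hsec : (s.op.star ((s.star τ).star t.op)).star t = τ := by
    rw [star_assoc, star_assoc (s.star τ), op_star_self hj2, star_assoc s, star_eSection hr,
      ← star_assoc, op_star_self hi2, eSection_star hl]
  refine ⟨Pi.single c (Matrix.single i j (MonoidAlgebra.single γ 1)), ?_⟩
  change (linkFrame k rep hrep enum).algHom _ = _
  rw [MatrixFrame.algHom_single, hρ, cornerHom_single, hu, hv, hγ]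
  have h1 : fIdem k z * scaledBasis k s.op = scaledBasis k s.op * fIdem k (rep c) :=
    fIdem_mul_scaledBasis ((leftInv_op s).trans hi2) ((rightInv_op s).trans hi1)
  calc fIdem k z * scaledBasis k s.op *
        (fIdem k (rep c) * scaledBasis k ((s.star τ).star t.op)) * (scaledBasis k t * fIdem k w)
      = fIdem k z * (scaledBasis k s.op * fIdem k (rep c)) *
          scaledBasis k ((s.star τ).star t.op) * scaledBasis k t * fIdem k w := by
        simp only [mul_assoc]
    _ = (fIdem k z * fIdem k z) * (scaledBasis k s.op *
          scaledBasis k ((s.star τ).star t.op) * scaledBasis k t) * fIdem k w := by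
        rw [← h1]
        simp only [mul_assoc]
    _ = fIdem k z * (scaledBasis k τ * fIdem k w) := by
        rw [fIdem_mul_self, scaledBasis_mul k hs.op ((hs.star hτ).star ht.op),
          scaledBasis_mul k (hs.op.star ((hs.star hτ).star ht.op)) ht, hsec, mul_assoc]
    _ = fIdem k z * scaledBasis k τ := by
        rw [← fIdem_mul_scaledBasis hl hr, ← mul_assoc, fIdem_mul_self]

theorem scaledBasis_mem_range {σ : GroupSection (G × G)} (hσ : IsCovering σ) :
    scaledBasis k σ ∈ (linkFrame k rep hrep enum).algHom.range := by
  obtain ⟨x, hx⟩ := hσ.exists_leftInv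
  rw [← one_mul (scaledBasis k σ), ← sum_fIdem, Finset.sum_mul]
  refine sum_mem fun z _ => ?_
  by_cases hxz : x ≤ z
  · obtain ⟨w, hw⟩ := ((isCovering_eSection z).star hσ).exists_rightInv
    rw [fIdem_mul_scaledBasis_eq_star hσ]
    exact fIdem_mul_scaledBasis_mem_range rep hrep enum (leftInv_eSection_star hxz hx) hw
  · rw [fIdem_mul_scaledBasis_of_not_le hσ hx hxz]
    exact zero_mem _

theorem linkFrame_algHom_injective :
    Function.Injective (linkFrame k rep hrep enum).algHom :=
  MatrixFrame.algHom_injective _ fun c => cornerHom_injective (rep c)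

theorem linkFrame_algHom_range :
    (linkFrame k rep hrep enum).algHom.range = coveringAlgebra k G := by
  apply le_antisymm
  · rintro _ ⟨M, rfl⟩
    exact MatrixFrame.algHom_mem _ _ (fun c => cornerHom_mem (rep c))
      (fun c i => mul_mem (fIdem_mem _) (scaledBasis_mem k (isCovering_link rep hrep enum c i).op))
      (fun c i => mul_mem (scaledBasis_mem k (isCovering_link rep hrep enum c i)) (fIdem_mem _)) M
  · intro a ha
    change a ∈ Subalgebra.toSubmodule (linkFrame k rep hrep enum).algHom.range
    refine Submodule.span_le.2 ?_ ha
    rintro _ ⟨σ, hσ, rfl⟩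
    have h0 : ((p₁ σ.S).index : k) ≠ 0 := Nat.cast_ne_zero.2 Subgroup.index_ne_zero_of_finite
    have h : basis k σ = ((p₁ σ.S).index : k) • scaledBasis k σ := by
      rw [scaledBasis, smul_smul, mul_inv_cancel₀ h0, one_smul]
    rw [h]
    exact Subalgebra.smul_mem _ (scaledBasis_mem_range rep hrep enum hσ) _

end Decomposition

end SectionBurnside

end

theorem mainTheorem2 {k : Type v} [Field k] [CharZero k] {G : Type u} [Group G] [Finite G]
    (rep : SectionBurnside.LinkageClass G → SectionBurnside.GPair G)
    (hrep : ∀ c, SectionBurnside.linkageClass (rep c) = c)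
    (enum : ∀ c : SectionBurnside.LinkageClass G, Fin (Nat.card c.Members) ≃ c.Members) :
    ∃ φ : SectionBurnside.coveringAlgebra k G ≃ₐ[k]
        (∀ c : SectionBurnside.LinkageClass G,
          Matrix (Fin (Nat.card c.Members)) (Fin (Nat.card c.Members))
            (MonoidAlgebra k (SectionBurnside.Gamma k (rep c)))),
      ∀ (c : SectionBurnside.LinkageClass G) (i : Fin (Nat.card c.Members)),
        ∃ hf : SectionBurnside.fIdem k (enum c i).1 ∈ SectionBurnside.coveringAlgebra k G,
          φ ⟨SectionBurnside.fIdem k (enum c i).1, hf⟩ c = Matrix.single i i 1 ∧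
            ∀ d, d ≠ c → φ ⟨SectionBurnside.fIdem k (enum c i).1, hf⟩ d = 0 := by
  classical
  let ψ := (AlgEquiv.ofInjective _
    (SectionBurnside.linkFrame_algHom_injective (k := k) rep hrep enum)).trans
      (Subalgebra.equivOfEq _ _ (SectionBurnside.linkFrame_algHom_range rep hrep enum))
  refine ⟨ψ.symm, fun c i => ⟨SectionBurnside.fIdem_mem _, ?_⟩⟩
  have h : ψ.symm ⟨SectionBurnside.fIdem k (enum c i).1, SectionBurnside.fIdem_mem _⟩ =
      Pi.single c (Matrix.single i i 1) := by
    rw [AlgEquiv.symm_apply_eq]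
    exact Subtype.ext (SectionBurnside.linkFrame_single_one rep hrep enum c i).symm
  rw [h]
  exact ⟨Pi.single_eq_same _ _, fun d hd => Pi.single_eq_of_ne hd _⟩
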